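/- Let $(\mathcal Z(u))_{u}$, indexed by the finite words $u=u_1\ldots u_n$ of positive integers, be i.i.d. copies of a point process $\mathcal Z=\sum_{j=1}^N\delta_{X_j}$ on $\mathbb R$, with $N\in\{0,1,2,\ldots\}\cup\{\infty\}$ and no assumption on the joint law of $N,X_1,X_2,\ldots$; write $\mathcal Z(u)=\sum_{j=1}^{N(u)}\delta_{X_j(u)}$, the enumerated data $(N(u),X_1(u),X_2(u),\ldots)$ being i.i.d. in $u$. In the associated branching random walk the ancestor $\varnothing$ is at $S(\varnothing)=0$, and each individual $u$ that is born has the children $uj$, $1\le j\le N(u)$ ($j\in\mathbb N$ if $N(u)=\infty$), at the positions $S(uj)=S(u)+X_j(u)$. Assume $\mathbb E[N]>1$. For $\theta\in\mathbb R$ put $m(\theta)=\mathbb E\big[\sum_{j=1}^N e^{-\theta X_j}\big]\in[0,\infty]$. Fix $\theta$ with $m(\theta)<\infty$ and let $$W_n(\theta)=m(\theta)^{-n}\sum_{|u|=n}e^{-\theta S(u)},\qquad n\ge 0,$$ the sum being over the individuals born in generation $n$. Let $\alpha\in(1,2)$ and suppose that $$\kappa:=\frac{m(\alpha\theta)}{m(\theta)^\alpha}<1\qquad\text{and}\qquad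 \mathbb P(W_1(\theta)>x)\sim x^{-\alpha}\ell(x)\quad(x\to\infty)$$ for a function $\ell$ slowly varying at $\infty$. Suppose moreover that at least one of the following holds: (i) $m((\alpha+\varepsilon)\theta)<\infty$ for some $\varepsilon>0$; (ii) $\lim_{x\to\infty}\ell(x)=c$ for some $c\in(0,\infty)$. Then for every bounded real sequence $(a_j)_{j\ge0}$ the series $\sum_{j\ge0}a_j(W_{j+1}(\theta)-W_j(\theta))$ converges almost surely and in $L_p$ for every $p\in[1,\alpha)$, and, as $x\to\infty$, $$\frac{\mathbb P\big(\sum_{j\ge0}a_j(W_{j+1}(\theta)-W_j(\theta))>x\big)}{\mathbb P(W_1(\theta)>x)}\longrightarrow\sum_{j\ge0}\kappa^j(a_j^+)^\alpha,$$ $$\frac{\mathbb P\big(\sum_{j\ge0}a_j(W_{j+1}(\theta)-W_j(\theta))<-x\big)}{\mathbb P(W_1(\theta)>x)}\longrightarrow\sum_{j\ge0}\kappa^j(a_j^-)^\alpha,$$ where $y^{\pm}=\max(\pm y,0)$. In particular, $W_n(\theta)$ converges almost surely to a random variable $W(\theta)$ with $$\mathbb P(W(\theta)>x)\sim(1-\kappa)^{-1}\,\mathbb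 P(W_1(\theta)>x)\qquad(x\to\infty).$$ -/

import Mathlib

open MeasureTheory ProbabilityTheory Filter Topology
open scoped ENNReal

/-- A function `ℓ` is slowly varying at infinity: it is positive and measurable on some
half-line `[x₀, ∞)`, and `ℓ (c x) / ℓ x → 1` as `x → ∞` for every `c > 0`. -/
structure SlowlyVarying (ℓ : ℝ → ℝ) : Prop where
  measurable_pos : ∃ x₀ : ℝ, (∀ x, x₀ ≤ x → 0 < ℓ x) ∧ Measurable (fun x : Set.Ici x₀ => ℓ x)
  tendsto_ratio : ∀ c : ℝ, 0 < c → Tendsto (fun x => ℓ (c * x) / ℓ x) atTop (𝓝 1)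

/-- The data of a branching random walk on a probability space `(Ω, P)`. Individuals are labelled
by finite words of natural numbers, the last letter of the word being the head of the list: the
ancestor is `[]`, and the children of `u` are `j :: u` for the `j = 0, 1, 2, …` with `j < N u`.
The child `j :: u` is displaced by `X u j` from `u` (the values `X u j` with `N u ≤ j` are never
used). The reproduction data `(N u, (X u j)_j)` of different individuals are independent and
identically distributed; nothing is assumed on the joint law of `N u, X u 0, X u 1, …` for one
individual `u`. -/
structure BranchingRandomWalk {Ω : Type*} [MeasurableSpace Ω] (P : Measure Ω) where
  /-- the number of children of `u`, possibly infinite -/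
  N : List ℕ → Ω → ℕ∞
  /-- the displacements of the children of `u` -/
  X : List ℕ → ℕ → Ω → ℝ
  measurable_N : ∀ u, Measurable (N u)
  measurable_X : ∀ u j, Measurable (X u j)
  indep : iIndepFun (fun (u : List ℕ) (ω : Ω) => (N u ω, fun j : ℕ => X u j ω)) P
  identDistrib : ∀ u : List ℕ, IdentDistrib (fun ω => (N u ω, fun j : ℕ => X u j ω))
    (fun ω => (N [] ω, fun j : ℕ => X [] j ω)) P P

namespace BranchingRandomWalk

variable {Ω : Type*} [MeasurableSpace Ω] {P : Measure Ω} (B : BranchingRandomWalk P)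

/-- The point process `∑_{j < N u} δ_{X u j}` of displacements of the children of `u`. -/
noncomputable def offspring (u : List ℕ) (ω : Ω) : Measure ℝ :=
  Measure.sum (fun j : {j : ℕ // (j : ℕ∞) < B.N u ω} => Measure.dirac (B.X u j ω))

/-- The position `S(u)`. -/
def position : List ℕ → Ω → ℝ
  | [], _ => 0
  | j :: u, ω => position u ω + B.X u j ω

/-- The potential individual `u` is actually born. -/
def Born : List ℕ → Ω → Prop
  | [], _ => True
  | j :: u, ω => Born u ω ∧ (j : ℕ∞) < B.N u ω

/-- The point process of the positions of the individuals of generation `n`. -/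
noncomputable def generation (n : ℕ) (ω : Ω) : Measure ℝ :=
  Measure.sum (fun u : {u : List ℕ // u.length = n ∧ B.Born u ω} =>
    Measure.dirac (B.position u ω))

/-- Supercriticality: the mean number of children exceeds one. -/
def Supercritical : Prop := 1 < ∫⁻ ω, (B.N [] ω : ℝ≥0∞) ∂P

/-- The Laplace transform `m(θ) = E[∫ e^{-θ x} 𝒵(dx)] ∈ [0, ∞]` of the intensity measure. -/
noncomputable def m (θ : ℝ) : ℝ≥0∞ :=
  ∫⁻ ω, ∫⁻ x, ENNReal.ofReal (Real.exp (-θ * x)) ∂(B.offspring [] ω) ∂P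

/-- Biggins' martingale `W_n(θ) = m(θ)^{-n} ∫ e^{-θ x} 𝒵_n(dx)`. -/
noncomputable def W (θ : ℝ) (n : ℕ) (ω : Ω) : ℝ :=
  ((∫⁻ x, ENNReal.ofReal (Real.exp (-θ * x)) ∂(B.generation n ω)) / B.m θ ^ n).toReal

/-- `κ = m(αθ) / m(θ)^α`, as an extended nonnegative real. -/
noncomputable def kappa (α θ : ℝ) : ℝ≥0∞ := B.m (α * θ) / B.m θ ^ α

/-- The partial sums `∑_{j < n} a_j (W_{j+1}(θ) - W_j(θ))`. -/
noncomputable def partialSum (θ : ℝ) (a : ℕ → ℝ) (n : ℕ) (ω : Ω) : ℝ :=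
  ∑ j ∈ Finset.range n, a j * (B.W θ (j + 1) ω - B.W θ j ω)

end BranchingRandomWalk

/-!
Write `L(u) = e^{-θ S(u)} / m(θ)^{|u|}` for the weight of an individual that is born (`lineWeight`)
and `Y_u` for the centred copy of `W_1` rooted at `u` (`fluct`). Almost surely
`W_{n+1} - W_n = ∑_{|u| = n} L(u) Y_u` (`ae_hasSum_increment`), so the series of the theorem is the
sum of `c_u Y_u` over all words `u`, with `c_u = a_{|u|} L(u)`. If words are added in an order of
nondecreasing length, each `Y_u` is independent of its coefficient and of all preceding terms
(`indepFun_sum_fluct`). The tail of the series is therefore governed by a single big jump: it is the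
sum over `u` of the tails of `c_u Y_u`, and `P(c_u Y_u > x) ~ E[(c_u⁺)^α] P(W_1 > x)`. Since
`E ∑_{|u| = j} L(u)^p = k(p)^j` with `k(p) = m(pθ) / m(θ)^p` (`tsum_lintegral_lineWeight`) and
`k(α) = κ`, these constants add up to `∑_j κ^j (a_j⁺)^α`.

Three facts make this rigorous.

* Moments. `k(1) = 1`, `k(α) < 1` and convexity give `k(p) < 1` for `1 < p ≤ α` (`moment_lt_one`).
  A function `φ` whose first-order Taylor remainder is bounded by `χ` satisfies
  `E φ(∑ c_u Y_u) ≤ ∑ E χ(c_u Y_u)` (`integral_sum_term_le`, `lintegral_hasSum_term_le`). With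
  `φ(x) = |x|^p` this makes the increments of the martingale decay geometrically in `L_p` for every
  `p ∈ (1, α)`, hence the almost sure and the `L_p` convergence.

* Uniform tail bounds. The alternative (i) or (ii) yields `γ ∈ [α, 2)` with `k(γ) < 1` and a Potter
  bound `P(W_1 > x / c) ≤ K (c^β + c^γ) P(W_1 > x)` for all `c > 0` and all large `x`
  (`exists_potterBound`), where `1 < β < α`. The same inequality with `φ(x) = √(1 + x²) - 1`,
  which is quadratic near `0` and linear at infinity, then bounds the tail of any remainder
  `∑_{u ∉ s} c_u Y_u` by a multiple of `∑_{u ∉ s} E[|c_u|^β + |c_u|^γ] · P(W_1 > x)`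
  (`FluctBound.measureReal_remainder_le`). As `∑_u E[|c_u|^β + |c_u|^γ]` is finite, finitely many
  words suffice.

* Finite sums. For finite `s` the tail of `∑_{u ∈ s} c_u Y_u` is found by adding one word at a time
  (`IsBigJumpTerm.tendsto_tail_add`): dominated convergence gives a version of Breiman's lemma for
  `c_u Y_u`, and shows that this term and the preceding sum are both large only with probability
  `o(P(W_1 > x))`.

The left tail is the right tail for `-a`, and `W = 1 + R` for the limit `R` belonging to `a = 1`.
-/

/-! ### Regularly varying tails -/

/-- `F` is regularly varying at infinity with index `-α`. -/
def IsRegVar (F : ℝ → ℝ) (α : ℝ) : Prop :=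
  ∀ c : ℝ, 0 < c → Tendsto (fun x => F (c * x) / F x) atTop (𝓝 (c ^ (-α)))

/-- A Potter-type bound that holds for *all* scales `c > 0`, uniformly in large `x`. Here `β` is
the exponent that matters for small `c`, and `γ` the one that matters for large `c`. -/
def PotterBound (F : ℝ → ℝ) (β γ : ℝ) : Prop :=
  ∃ K x₀ : ℝ, 0 < K ∧ 0 < x₀ ∧ ∀ x, x₀ ≤ x → ∀ c, 0 < c → F (x / c) ≤ K * (c ^ β + c ^ γ) * F x

theorem isRegVar_of_isEquivalent {F ℓ : ℝ → ℝ} {α : ℝ} (hℓ : SlowlyVarying ℓ)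
    (h : Asymptotics.IsEquivalent atTop F (fun x : ℝ => x ^ (-α) * ℓ x)) : IsRegVar F α := by
  obtain ⟨x₀, hpos, -⟩ := hℓ.measurable_pos
  have hne : ∀ᶠ x in atTop, x ^ (-α) * ℓ x ≠ 0 := by
    filter_upwards [eventually_ge_atTop x₀, eventually_gt_atTop 0] with x hx h0
    exact (mul_pos (Real.rpow_pos_of_pos h0 _) (hpos x hx)).ne'
  have h1 := (Asymptotics.isEquivalent_iff_tendsto_one hne).1 h
  intro c hc
  have hcx : Tendsto (fun x : ℝ => c * x) atTop atTop := tendsto_id.const_mul_atTop hc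
  have h2 := h1.comp hcx
  have h3 := ((h2.div h1 one_ne_zero).mul (hℓ.tendsto_ratio c hc)).mul_const (c ^ (-α))
  simp only [div_one, one_mul] at h3
  refine h3.congr' ?_
  filter_upwards [hne, hcx.eventually hne, eventually_gt_atTop 0,
    eventually_ge_atTop x₀, hcx.eventually_ge_atTop x₀] with x h4 h5 h0 h6 h7
  have e1 := (hpos _ h6).ne'
  have e2 := (hpos _ h7).ne'
  have e3 := (Real.rpow_pos_of_pos h0 (-α)).ne'
  have e4 := (Real.rpow_pos_of_pos hc (-α)).ne'
  simp only [Function.comp, Pi.div_apply, Real.mul_rpow hc.le h0.le]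
  by_cases e5 : F x = 0
  · simp [e5]
  field_simp

theorem eventually_pos_of_isEquivalent {F ℓ : ℝ → ℝ} {α : ℝ} (hℓ : SlowlyVarying ℓ)
    (h : Asymptotics.IsEquivalent atTop F (fun x : ℝ => x ^ (-α) * ℓ x)) :
    ∀ᶠ x in atTop, 0 < F x := by
  obtain ⟨x₀, hpos, -⟩ := hℓ.measurable_pos
  have hp : ∀ᶠ x in atTop, 0 < x ^ (-α) * ℓ x := by
    filter_upwards [eventually_ge_atTop x₀, eventually_gt_atTop 0] with x hx h0
    exact mul_pos (Real.rpow_pos_of_pos h0 _) (hpos x hx)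
  have h1 := (Asymptotics.isEquivalent_iff_tendsto_one (hp.mono fun x hx => hx.ne')).1 h
  filter_upwards [hp, h1.eventually (lt_mem_nhds zero_lt_one)] with x hx h2
  simpa using (div_pos_iff_of_pos_right hx).1 h2

/-- For a monotone regularly varying function Potter's bound follows by iterating the comparison
of `F (2 x)` with `F x`. -/
theorem potterBound_of_isRegVar {F : ℝ → ℝ} {α β γ : ℝ} (hF : Antitone F) (hpos : ∀ x, 0 < F x)
    (hle : ∀ x, F x ≤ 1) (h : IsRegVar F α) (hβ : 0 < β) (hβα : β < α) (hαγ : α < γ) :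
    PotterBound F β γ := by
  have h2 := h 2 two_pos
  have hlt1 : (2 : ℝ) ^ (-α) < 2 ^ (-β) := Real.rpow_lt_rpow_of_exponent_lt one_lt_two (by linarith)
  have hlt2 : (2 : ℝ) ^ (-γ) < 2 ^ (-α) := Real.rpow_lt_rpow_of_exponent_lt one_lt_two (by linarith)
  obtain ⟨x₀, hx₀⟩ := eventually_atTop.1 (((h2.eventually (gt_mem_nhds hlt1)).and
    (h2.eventually (lt_mem_nhds hlt2))).and (eventually_gt_atTop (0 : ℝ)))
  have hx₀pos : 0 < x₀ := (hx₀ x₀ le_rfl).2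
  have up : ∀ x, x₀ ≤ x → F (2 * x) ≤ 2 ^ (-β) * F x := fun x hx =>
    ((div_lt_iff₀ (hpos x)).1 (hx₀ x hx).1.1).le
  have lo : ∀ x, x₀ ≤ x → F x ≤ 2 ^ γ * F (2 * x) := fun x hx => by
    have := ((lt_div_iff₀ (hpos x)).1 (hx₀ x hx).1.2).le
    rw [Real.rpow_neg two_pos.le, inv_mul_le_iff₀ (by positivity)] at this
    exact this
  have ge : ∀ (n : ℕ) x, x₀ ≤ x → x₀ ≤ 2 ^ n * x := fun n x hx => by
    have : (1 : ℝ) ≤ 2 ^ n := one_le_pow₀ one_le_two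
    nlinarith
  have upn : ∀ (n : ℕ) x, x₀ ≤ x → F (2 ^ n * x) ≤ ((2 : ℝ) ^ (-β)) ^ n * F x := by
    intro n x hx
    induction n with
    | zero => simp
    | succ n ih =>
      have := up _ (ge n x hx)
      rw [pow_succ', mul_assoc, pow_succ', mul_assoc]
      exact this.trans (by gcongr)
  have lon : ∀ (n : ℕ) x, x₀ ≤ x → F x ≤ ((2 : ℝ) ^ γ) ^ n * F (2 ^ n * x) := by
    intro n x hx
    induction n with
    | zero => simp
    | succ n ih =>
      have := lo _ (ge n x hx)
      rw [pow_succ' (2 : ℝ), mul_assoc, pow_succ ((2 : ℝ) ^ γ), mul_assoc]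
      exact ih.trans (by gcongr)
  have hγ : 0 < γ := by linarith
  have small : ∀ x, x₀ ≤ x → ∀ c, 0 < c → c ≤ 1 → F (x / c) ≤ 2 ^ β * c ^ β * F x := by
    intro x hx c hc hc1
    obtain ⟨n, hn1, hn2⟩ := exists_nat_pow_near ((one_le_inv₀ hc).2 hc1) one_lt_two
    have e1 : F (x / c) ≤ F (2 ^ n * x) := hF (by
      rw [div_eq_inv_mul]; exact mul_le_mul_of_nonneg_right hn1 (by linarith))
    refine (e1.trans (upn n x hx)).trans (mul_le_mul_of_nonneg_right ?_ (hpos x).le)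
    rw [← Real.mul_rpow two_pos.le hc.le, Real.rpow_neg two_pos.le, inv_pow,
      ← Real.rpow_natCast, ← Real.rpow_mul two_pos.le, mul_comm β, Real.rpow_mul two_pos.le,
      Real.rpow_natCast, ← Real.inv_rpow (by positivity)]
    refine Real.rpow_le_rpow (by positivity) ?_ hβ.le
    rw [inv_le_iff_one_le_mul₀ (by positivity)]
    rw [inv_lt_iff_one_lt_mul₀ hc, pow_succ] at hn2
    nlinarith
  have large : ∀ x c, 1 ≤ c → x₀ ≤ x / c → F (x / c) ≤ 2 ^ γ * c ^ γ * F x := by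
    intro x c hc hx
    have hc0 : 0 < c := by linarith
    obtain ⟨n, hn1, hn2⟩ := exists_nat_pow_near hc one_lt_two
    have e1 : F (2 ^ (n + 1) * (x / c)) ≤ F x := hF (by
      rw [← mul_div_assoc, le_div_iff₀ hc0, mul_comm]
      have : 0 ≤ x := by
        have := (div_pos_iff_of_pos_right hc0).1 (hx₀pos.trans_le hx); exact this.le
      exact mul_le_mul_of_nonneg_right hn2.le this)
    refine (lon (n + 1) _ hx).trans (mul_le_mul ?_ e1 (hpos _).le (by positivity))
    rw [← Real.mul_rpow two_pos.le hc0.le, ← Real.rpow_natCast, ← Real.rpow_mul two_pos.le,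
      mul_comm γ, Real.rpow_mul two_pos.le, Real.rpow_natCast]
    refine Real.rpow_le_rpow (by positivity) ?_ hγ.le
    rw [pow_succ]; linarith
  refine ⟨2 ^ β + 2 ^ γ / F x₀, x₀, by have := hpos x₀; positivity, hx₀pos, fun x hx c hc => ?_⟩
  have cβ := Real.rpow_pos_of_pos hc β
  have cγ := Real.rpow_pos_of_pos hc γ
  have tβ : (0 : ℝ) < 2 ^ β := by positivity
  have tγ : (0 : ℝ) < 2 ^ γ := by positivity
  have hF0 := hpos x₀
  have t2 : (2 : ℝ) ^ γ ≤ 2 ^ γ / F x₀ := by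
    rw [le_div_iff₀ hF0]; nlinarith [hle x₀]
  have t3 : 0 < (2 : ℝ) ^ γ / F x₀ := by positivity
  -- `x / c` lies beyond `x`, between `x₀` and `x`, or below `x₀`
  rcases le_total c 1 with hc1 | hc1
  · refine (small x hx c hc hc1).trans (mul_le_mul_of_nonneg_right ?_ (hpos x).le)
    nlinarith [mul_pos tβ cγ, mul_pos t3 cβ, mul_pos t3 cγ]
  rcases le_total x₀ (x / c) with hxc | hxc
  · refine (large x c hc1 hxc).trans (mul_le_mul_of_nonneg_right ?_ (hpos x).le)
    nlinarith [mul_pos tβ cγ, mul_pos t3 cβ, mul_pos tβ cβ, mul_le_mul_of_nonneg_right t2 cγ.le]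
  · -- `F (x / c) ≤ 1`, and `F x₀` is comparable with `F x` on the scale `x / x₀ ≤ c`
    have h1 : x / (x / x₀) = x₀ := by
      have : 0 < x := hx₀pos.trans_le hx
      field_simp
    have h2 := large x (x / x₀) ((one_le_div hx₀pos).2 hx) h1.ge
    rw [h1] at h2
    have h3 : (x / x₀) ^ γ ≤ c ^ γ := by
      refine Real.rpow_le_rpow (by have := hx₀pos.le.trans hx; positivity) ?_ hγ.le
      rw [div_le_iff₀ hx₀pos, mul_comm]; rwa [div_le_iff₀ hc] at hxc
    have h4 : F (x / c) ≤ 2 ^ γ / F x₀ * c ^ γ * F x := by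
      refine (hle _).trans ?_
      have : (2 : ℝ) ^ γ / F x₀ * c ^ γ * F x = 2 ^ γ * c ^ γ * F x / F x₀ := by ring
      rw [this, le_div_iff₀ hF0, one_mul]
      refine h2.trans (mul_le_mul_of_nonneg_right ?_ (hpos x).le)
      exact mul_le_mul_of_nonneg_left h3 tγ.le
    refine h4.trans (mul_le_mul_of_nonneg_right ?_ (hpos x).le)
    nlinarith [mul_pos tβ cγ, mul_pos t3 cβ, mul_pos tβ cβ]

/-- If `F` is of exact order `x ^ (-α)`, then Potter's bound holds with the exponent `α` itself. -/
theorem potterBound_of_tendsto {F ℓ : ℝ → ℝ} {α β c₀ : ℝ}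
    (hle : ∀ x, F x ≤ 1) (h : Asymptotics.IsEquivalent atTop F (fun x : ℝ => x ^ (-α) * ℓ x))
    (hc₀ : 0 < c₀) (hℓ : Tendsto ℓ atTop (𝓝 c₀)) (hα : 0 < α) :
    PotterBound F β α := by
  have hne : ∀ᶠ x in atTop, x ^ (-α) * ℓ x ≠ 0 := by
    filter_upwards [eventually_gt_atTop 0, hℓ.eventually (lt_mem_nhds hc₀)] with x h0 h1
    exact (mul_pos (Real.rpow_pos_of_pos h0 _) h1).ne'
  have h1 := ((Asymptotics.isEquivalent_iff_tendsto_one hne).1 h).mul hℓ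
  rw [one_mul] at h1
  obtain ⟨x₀, hx₀⟩ := eventually_atTop.1 ((((h1.eventually (gt_mem_nhds (show c₀ < 2 * c₀ by linarith))).and
    (h1.eventually (lt_mem_nhds (show c₀ / 2 < c₀ by linarith)))).and
    (eventually_gt_atTop (0 : ℝ))).and hne)
  have hx₀pos : 0 < x₀ := (hx₀ x₀ le_rfl).1.2
  have hval : ∀ x, x₀ ≤ x → F x / (x ^ (-α) * ℓ x) * ℓ x = F x * x ^ α := by
    intro x hx
    have h0 := (hx₀ x hx).1.2
    have h3 := (hx₀ x hx).2
    have h4 : ℓ x ≠ 0 := fun h => h3 (by simp [h])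
    rw [Real.rpow_neg h0.le]
    have := (Real.rpow_pos_of_pos h0 α).ne'
    field_simp
  have hup : ∀ x, x₀ ≤ x → F x * x ^ α ≤ 2 * c₀ := fun x hx => by
    rw [← hval x hx]; exact (hx₀ x hx).1.1.1.le
  have hlo : ∀ x, x₀ ≤ x → c₀ / 2 ≤ F x * x ^ α := fun x hx => by
    rw [← hval x hx]; exact (hx₀ x hx).1.1.2.le
  have hall : ∀ y, 0 < y → F y * y ^ α ≤ 2 * c₀ + x₀ ^ α := by
    intro y hy
    have hp : 0 < x₀ ^ α := Real.rpow_pos_of_pos hx₀pos α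
    rcases le_total x₀ y with hxy | hxy
    · linarith [hup y hxy]
    · have h3 : y ^ α ≤ x₀ ^ α := Real.rpow_le_rpow hy.le hxy hα.le
      have h4 := Real.rpow_pos_of_pos hy α
      nlinarith [hle y]
  refine ⟨2 * (2 * c₀ + x₀ ^ α) / c₀, x₀, by positivity, hx₀pos, fun x hx c hc => ?_⟩
  have hx0 : 0 < x := (hx₀ x hx).1.2
  have e1 := hall (x / c) (by positivity)
  have e2 := hlo x hx
  have hxα := Real.rpow_pos_of_pos hx0 α
  have hcα := Real.rpow_pos_of_pos hc α
  have hcβ := Real.rpow_pos_of_pos hc β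
  rw [Real.div_rpow hx0.le hc.le, ← mul_div_assoc, div_le_iff₀ hcα] at e1
  have hFx : 0 < F x := by
    by_contra hcon
    nlinarith
  have hD : 0 < 2 * c₀ + x₀ ^ α := by positivity
  have e3 : F (x / c) ≤ 2 * (2 * c₀ + x₀ ^ α) / c₀ * c ^ α * F x := by
    have e4 : F (x / c) * x ^ α ≤ (2 * (2 * c₀ + x₀ ^ α) / c₀ * c ^ α * F x) * x ^ α := by
      refine e1.trans ?_
      have : (2 * (2 * c₀ + x₀ ^ α) / c₀ * c ^ α * F x) * x ^ α
        = (2 * c₀ + x₀ ^ α) * c ^ α * (2 / c₀ * (F x * x ^ α)) := by ring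
      rw [this]
      refine le_mul_of_one_le_right (by positivity) ?_
      rw [div_mul_eq_mul_div, le_div_iff₀ hc₀]; linarith
    exact le_of_mul_le_mul_right e4 hxα
  refine e3.trans (mul_le_mul_of_nonneg_right ?_ hFx.le)
  have : 0 < 2 * (2 * c₀ + x₀ ^ α) / c₀ := by positivity
  nlinarith [mul_pos this hcβ]

/-! ### A quadratic-linear function and its expectation under a regularly varying tail -/

/-- The even function that equals `2 b ^ 2` near the origin and `2 |b|` far from it. It bounds the
second-order Taylor remainder of `b ↦ √(1 + b ^ 2)`, uniformly in the base point. -/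
noncomputable def quadLin (b : ℝ) : ℝ := 2 * min (b ^ 2) |b|

theorem quadLin_nonneg (b : ℝ) : 0 ≤ quadLin b := by unfold quadLin; positivity

theorem quadLin_le_abs (b : ℝ) : quadLin b ≤ 2 * |b| := by
  unfold quadLin; gcongr; exact min_le_right _ _

theorem measurable_quadLin : Measurable quadLin := by unfold quadLin; fun_prop

theorem quadLin_mono {a b : ℝ} (h : |a| ≤ |b|) : quadLin a ≤ quadLin b := by
  unfold quadLin
  exact mul_le_mul_of_nonneg_left (min_le_min (sq_le_sq.2 h) h) zero_le_two

theorem one_le_quadLin {b : ℝ} (h : 1 ≤ |b|) : 1 ≤ quadLin b := by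
  have := quadLin_mono (a := 1) (b := b) (by simpa using h)
  have h1 : quadLin 1 = 2 := by norm_num [quadLin]
  linarith

theorem quadLin_le_rpow {b q : ℝ} (h1 : 1 ≤ q) (h2 : q ≤ 2) : quadLin b ≤ 2 * |b| ^ q := by
  unfold quadLin
  refine mul_le_mul_of_nonneg_left ?_ zero_le_two
  rcases le_total |b| 1 with hb | hb
  · rcases (abs_nonneg b).eq_or_lt with h0 | h0
    · rw [← h0]; exact (min_le_right _ _).trans (Real.rpow_nonneg le_rfl _)
    · refine (min_le_left _ _).trans ?_
      rw [← sq_abs, ← Real.rpow_natCast]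
      exact Real.rpow_le_rpow_of_exponent_ge h0 hb (by simpa using h2)
  · refine (min_le_right _ _).trans ?_
    simpa using Real.rpow_le_rpow_of_exponent_le hb h1

/-- The right-hand side has the form required by the layer cake formula. -/
theorem quadLin_le_integral {y : ℝ} (hy : 0 ≤ y) : quadLin y ≤ 4 * ∫ t in (0 : ℝ)..y, min t 1 := by
  have hint : ∀ a b : ℝ, IntervalIntegrable (fun t : ℝ => min t 1) volume a b := fun a b =>
    (by fun_prop : Continuous fun t : ℝ => min t 1).intervalIntegrable a b
  have hsmall : ∀ z : ℝ, 0 ≤ z → z ≤ 1 → ∫ t in (0 : ℝ)..z, min t 1 = z ^ 2 / 2 := by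
    intro z hz hz1
    rw [intervalIntegral.integral_congr (g := fun t => t)]
    · simp
    · intro t ht
      rw [Set.uIcc_of_le hz] at ht
      exact min_eq_left (ht.2.trans hz1)
  unfold quadLin
  rw [abs_of_nonneg hy]
  rcases le_total y 1 with h | h
  · rw [hsmall y hy h]
    have := min_le_left (y ^ 2) y
    linarith
  · rw [← intervalIntegral.integral_add_adjacent_intervals (hint 0 1) (hint 1 y),
      hsmall 1 zero_le_one le_rfl, intervalIntegral.integral_congr (g := fun _ => (1 : ℝ)) (a := 1)]
    · have := min_le_right (y ^ 2) y
      simp only [intervalIntegral.integral_const, smul_eq_mul]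
      linarith
    · intro t ht
      rw [Set.uIcc_of_le h] at ht
      exact min_eq_right ht.1

theorem lintegral_rpow_mul_min_lt_top {β : ℝ} (h1 : 1 < β) (h2 : β < 2) :
    ∫⁻ t in Set.Ioi (0 : ℝ), ENNReal.ofReal (t ^ (-β) * min t 1) < ∞ := by
  rw [← Set.Ioc_union_Ioi_eq_Ioi zero_le_one]
  refine (lintegral_union_le _ _ _).trans_lt (ENNReal.add_lt_top.2 ⟨?_, ?_⟩)
  · have h := (intervalIntegral.intervalIntegrable_rpow' (a := 0) (b := 1)
      (show -1 < 1 - β by linarith)).1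
    refine lt_of_le_of_lt ?_ h.lintegral_lt_top
    refine setLIntegral_mono' measurableSet_Ioc fun t ht => ENNReal.ofReal_le_ofReal ?_
    have e : t ^ (1 - β) = t ^ (-β) * t := by
      rw [sub_eq_neg_add, Real.rpow_add ht.1, Real.rpow_one]
    rw [e]
    exact mul_le_mul_of_nonneg_left (min_le_left _ _) (Real.rpow_nonneg ht.1.le _)
  · have h := integrableOn_Ioi_rpow_of_lt (a := -β) (c := 1) (by linarith) zero_lt_one
    refine lt_of_le_of_lt ?_ h.lintegral_lt_top
    refine setLIntegral_mono' measurableSet_Ioi fun t ht => ENNReal.ofReal_le_ofReal ?_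
    exact mul_le_of_le_one_right (Real.rpow_nonneg (zero_lt_one.trans ht).le _) (min_le_right _ _)

section Tail

variable {Ω : Type*} [MeasurableSpace Ω] {P : Measure Ω} [IsProbabilityMeasure P] {V : Ω → ℝ}

/-- The layer cake formula turns Potter's bound into a bound on the expectation; the integral over the
levels `t` converges at `0` because `γ < 2` and at infinity because `β > 1`. -/
theorem lintegral_quadLin_mul_le (hV : Measurable V) (hV0 : ∀ ω, 0 ≤ V ω) {β γ : ℝ}
    (hβ : 1 < β) (hγ : γ < 2) (hβγ : β ≤ γ)
    (hF : PotterBound (fun x => P.real {ω | V ω > x}) β γ) :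
    ∃ K x₀ : ℝ, 0 < K ∧ 0 < x₀ ∧ ∀ x, x₀ ≤ x → ∀ c, 0 < c →
      ∫⁻ ω, ENNReal.ofReal (quadLin (c * V ω / x)) ∂P ≤
        ENNReal.ofReal (K * (c ^ β + c ^ γ) * P.real {ω | V ω > x}) := by
  obtain ⟨K, x₀, hK, hx₀, hb⟩ := hF
  set I : ℝ≥0∞ := ∫⁻ t in Set.Ioi (0 : ℝ), (ENNReal.ofReal (t ^ (-β) * min t 1) +
    ENNReal.ofReal (t ^ (-γ) * min t 1)) with hI
  have hItop : I < ∞ := by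
    rw [hI, lintegral_add_left (by fun_prop)]
    exact ENNReal.add_lt_top.2 ⟨lintegral_rpow_mul_min_lt_top hβ (by linarith),
      lintegral_rpow_mul_min_lt_top (by linarith) hγ⟩
  refine ⟨4 * K * (I.toReal + 1), x₀, by positivity, hx₀, fun x hx c hc => ?_⟩
  have hx0 : 0 < x := hx₀.trans_le hx
  set F := P.real {ω | V ω > x} with hFdef
  have hF0 : 0 ≤ F := measureReal_nonneg
  have hf0 : ∀ ω, 0 ≤ c * V ω / x := fun ω => by have := hV0 ω; positivity
  calc ∫⁻ ω, ENNReal.ofReal (quadLin (c * V ω / x)) ∂P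
      ≤ ∫⁻ ω, 4 * ENNReal.ofReal (∫ t in (0 : ℝ)..(c * V ω / x), min t 1) ∂P := by
        refine lintegral_mono fun ω => ?_
        rw [show (4 : ℝ≥0∞) = ENNReal.ofReal 4 by simp, ← ENNReal.ofReal_mul (by norm_num)]
        exact ENNReal.ofReal_le_ofReal (quadLin_le_integral (hf0 ω))
    _ = 4 * ∫⁻ t in Set.Ioi (0 : ℝ), P {ω | t < c * V ω / x} * ENNReal.ofReal (min t 1) := by
        rw [lintegral_const_mul' _ _ (by simp), lintegral_comp_eq_lintegral_meas_lt_mul]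
        · exact Eventually.of_forall hf0
        · fun_prop
        · exact fun t _ => (by fun_prop : Continuous fun t : ℝ => min t 1).intervalIntegrable _ _
        · filter_upwards [self_mem_ae_restrict measurableSet_Ioi] with t ht
          exact le_min (le_of_lt ht) zero_le_one
    _ ≤ 4 * ∫⁻ t in Set.Ioi (0 : ℝ), ENNReal.ofReal (K * (c ^ β + c ^ γ) * F) *
          (ENNReal.ofReal (t ^ (-β) * min t 1) + ENNReal.ofReal (t ^ (-γ) * min t 1)) := by
        gcongr 4 * ?_
        refine setLIntegral_mono' measurableSet_Ioi fun t ht => ?_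
        have ht0 : (0 : ℝ) < t := ht
        have e1 : P {ω | t < c * V ω / x} = ENNReal.ofReal (P.real {ω | V ω > x / (c / t)}) := by
          rw [ofReal_measureReal]
          congr 1; ext ω
          simp only [Set.mem_ofPred_eq, gt_iff_lt]
          rw [lt_div_iff₀ hx0, div_div_eq_mul_div, div_lt_iff₀ hc, mul_comm x, mul_comm c]
        have hm : 0 ≤ min t 1 := le_min ht0.le zero_le_one
        have p1 := Real.rpow_pos_of_pos ht0 (-β)
        have p2 := Real.rpow_pos_of_pos ht0 (-γ)
        have p3 := Real.rpow_pos_of_pos hc β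
        have p4 := Real.rpow_pos_of_pos hc γ
        rw [e1, ← ENNReal.ofReal_add (by positivity) (by positivity),
          ← ENNReal.ofReal_mul (by positivity), ← ENNReal.ofReal_mul (by positivity)]
        refine ENNReal.ofReal_le_ofReal ?_
        refine (mul_le_mul_of_nonneg_right (hb x hx (c / t) (by positivity)) hm).trans ?_
        rw [Real.div_rpow hc.le ht0.le, Real.div_rpow hc.le ht0.le, div_eq_mul_inv, div_eq_mul_inv,
          ← Real.rpow_neg ht0.le, ← Real.rpow_neg ht0.le]
        have : (c ^ β * t ^ (-β) + c ^ γ * t ^ (-γ)) ≤ (c ^ β + c ^ γ) * (t ^ (-β) + t ^ (-γ)) := by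
          nlinarith [mul_pos p3 p2, mul_pos p4 p1]
        calc K * (c ^ β * t ^ (-β) + c ^ γ * t ^ (-γ)) * F * min t 1
            ≤ K * ((c ^ β + c ^ γ) * (t ^ (-β) + t ^ (-γ))) * F * min t 1 := by gcongr
          _ = _ := by ring
    _ = 4 * (ENNReal.ofReal (K * (c ^ β + c ^ γ) * F) * I) := by
        rw [lintegral_const_mul' _ _ (by simp)]
    _ ≤ ENNReal.ofReal (4 * K * (I.toReal + 1) * (c ^ β + c ^ γ) * F) := by
        have p3 := Real.rpow_pos_of_pos hc β
        have p4 := Real.rpow_pos_of_pos hc γ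
        rw [← ENNReal.ofReal_toReal hItop.ne, show (4 : ℝ≥0∞) = ENNReal.ofReal 4 by simp,
          ← ENNReal.ofReal_mul (by positivity), ← ENNReal.ofReal_mul (by norm_num)]
        refine ENNReal.ofReal_le_ofReal ?_
        simp only [ENNReal.toReal_ofReal ENNReal.toReal_nonneg]
        have : 0 ≤ 4 * K * (c ^ β + c ^ γ) * F := by positivity
        nlinarith

/-- Taking `c = x / x₀` in Potter's bound shows that `F` decays no faster than `x ^ (-γ)`. -/
theorem PotterBound.lower {F : ℝ → ℝ} {β γ : ℝ} (h : PotterBound F β γ) (hpos : ∀ x, 0 < F x)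
    (hβγ : β ≤ γ) : ∃ K x₀ : ℝ, 0 < K ∧ 0 < x₀ ∧ ∀ x, x₀ ≤ x → x ^ (-γ) ≤ K * F x := by
  obtain ⟨K, x₀, hK, hx₀, hb⟩ := h
  refine ⟨(2 * K) / (F x₀ * x₀ ^ γ), x₀, by have := hpos x₀; positivity, hx₀, fun x hx => ?_⟩
  have hx0 : 0 < x := hx₀.trans_le hx
  have h1 := hb x hx (x / x₀) (by positivity)
  rw [show x / (x / x₀) = x₀ by field_simp] at h1
  have h2 : (x / x₀) ^ β ≤ (x / x₀) ^ γ :=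
    Real.rpow_le_rpow_of_exponent_le ((one_le_div hx₀).2 hx) hβγ
  have h3 : F x₀ ≤ 2 * K * (x / x₀) ^ γ * F x := h1.trans (by
    refine mul_le_mul_of_nonneg_right ?_ (hpos x).le
    nlinarith)
  rw [Real.div_rpow hx0.le hx₀.le] at h3
  have p1 := Real.rpow_pos_of_pos hx0 γ
  have p2 := Real.rpow_pos_of_pos hx₀ γ
  have p3 := hpos x₀
  rw [Real.rpow_neg hx0.le, inv_le_iff_one_le_mul₀ p1]
  calc (1 : ℝ) = F x₀ / F x₀ := (div_self p3.ne').symm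
    _ ≤ (2 * K * (x ^ γ / x₀ ^ γ) * F x) / F x₀ := by gcongr
    _ = _ := by field_simp

/-- The truncated second moment of the fluctuation `V - 1` at scale `x / c`, and its tail mean, are
of the order of the tail of `V` at `x`, uniformly in the scale `c`. -/
theorem lintegral_quadLin_sub_one_le (hV : Measurable V) (hV0 : ∀ ω, 0 ≤ V ω) {β γ : ℝ}
    (hβ : 1 < β) (hγ : γ < 2) (hβγ : β ≤ γ) (hpos : ∀ x, 0 < P.real {ω | V ω > x})
    (hF : PotterBound (fun x => P.real {ω | V ω > x}) β γ) :
    ∃ K x₀ : ℝ, 0 < K ∧ 0 < x₀ ∧ ∀ x, x₀ ≤ x → ∀ c,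
      ∫⁻ ω, ENNReal.ofReal (quadLin (c * (V ω - 1) / x)) ∂P ≤
        ENNReal.ofReal (K * (|c| ^ β + |c| ^ γ) * P.real {ω | V ω > x}) := by
  obtain ⟨K₁, x₁, hK₁, hx₁, h1⟩ := lintegral_quadLin_mul_le hV hV0 hβ hγ hβγ hF
  obtain ⟨K₂, x₂, hK₂, hx₂, h2⟩ := hF.lower hpos hβγ
  refine ⟨2 * K₂ + K₁, max x₁ x₂, by positivity, by positivity, fun x hx c => ?_⟩
  have hx0 : 0 < x := hx₁.trans_le ((le_max_left _ _).trans hx)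
  have h2' := h2 x ((le_max_right _ _).trans hx)
  set F := P.real {ω | V ω > x} with hFdef
  have hF0 : 0 ≤ F := measureReal_nonneg
  by_cases hc : c = 0
  · simp [hc, quadLin]
  have hc' : 0 < |c| := abs_pos.2 hc
  have p1 := Real.rpow_pos_of_pos hc' β
  have p2 := Real.rpow_pos_of_pos hc' γ
  have hle : ∀ ω, quadLin (c * (V ω - 1) / x) ≤ quadLin (c / x) + quadLin (|c| * V ω / x) := by
    intro ω
    have hv := hV0 ω
    rcases le_total (V ω) 1 with h | h
    · have : quadLin (c * (V ω - 1) / x) ≤ quadLin (c / x) := by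
        apply quadLin_mono
        rw [abs_div, abs_div, abs_mul]
        gcongr
        refine mul_le_of_le_one_right hc'.le ?_
        rw [abs_le]; constructor <;> linarith
      linarith [quadLin_nonneg (|c| * V ω / x)]
    · have : quadLin (c * (V ω - 1) / x) ≤ quadLin (|c| * V ω / x) := by
        apply quadLin_mono
        have h' : |V ω - 1| ≤ |V ω| := by
          rw [abs_of_nonneg (by linarith), abs_of_nonneg hv]; linarith
        rw [abs_div, abs_div, abs_mul, abs_mul, abs_abs]
        exact div_le_div_of_nonneg_right (mul_le_mul_of_nonneg_left h' hc'.le) (abs_nonneg x)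
      linarith [quadLin_nonneg (c / x)]
  have e1 : quadLin (c / x) ≤ 2 * K₂ * |c| ^ γ * F := by
    refine (quadLin_le_rpow (hβ.le.trans hβγ) hγ.le).trans ?_
    rw [abs_div, abs_of_pos hx0, Real.div_rpow hc'.le hx0.le, div_eq_mul_inv, ← Real.rpow_neg hx0.le]
    have := mul_le_mul_of_nonneg_left h2' p2.le
    linarith
  calc ∫⁻ ω, ENNReal.ofReal (quadLin (c * (V ω - 1) / x)) ∂P
      ≤ ∫⁻ ω, (ENNReal.ofReal (quadLin (c / x)) + ENNReal.ofReal (quadLin (|c| * V ω / x))) ∂P := by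
        refine lintegral_mono fun ω => ?_
        rw [← ENNReal.ofReal_add (quadLin_nonneg _) (quadLin_nonneg _)]
        exact ENNReal.ofReal_le_ofReal (hle ω)
    _ = ENNReal.ofReal (quadLin (c / x)) + ∫⁻ ω, ENNReal.ofReal (quadLin (|c| * V ω / x)) ∂P := by
        rw [lintegral_add_left measurable_const]; simp
    _ ≤ ENNReal.ofReal (2 * K₂ * |c| ^ γ * F) +
          ENNReal.ofReal (K₁ * (|c| ^ β + |c| ^ γ) * F) :=
        add_le_add (ENNReal.ofReal_le_ofReal e1) (h1 x ((le_max_left _ _).trans hx) _ hc')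
    _ ≤ _ := by
        rw [← ENNReal.ofReal_add (by positivity) (by positivity)]
        refine ENNReal.ofReal_le_ofReal ?_
        have : 0 ≤ 2 * K₂ * |c| ^ β * F := by positivity
        nlinarith

theorem lintegral_rpow_lt_top_of_potterBound (hV : Measurable V) (hV0 : ∀ ω, 0 ≤ V ω) {p β γ : ℝ}
    (hp : 0 < p) (hpβ : p < β) (hβγ : β ≤ γ)
    (hF : PotterBound (fun x => P.real {ω | V ω > x}) β γ) :
    ∫⁻ ω, ENNReal.ofReal (V ω ^ p) ∂P < ∞ := by
  obtain ⟨K, x₀, hK, hx₀, hb⟩ := hF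
  rw [lintegral_rpow_eq_lintegral_meas_lt_mul P (Eventually.of_forall hV0) hV.aemeasurable hp]
  refine ENNReal.mul_lt_top (by simp) ?_
  rw [← Set.Ioc_union_Ioi_eq_Ioi zero_le_one]
  refine (lintegral_union_le _ _ _).trans_lt (ENNReal.add_lt_top.2 ⟨?_, ?_⟩)
  · have h := (intervalIntegral.intervalIntegrable_rpow' (a := 0) (b := 1)
      (show -1 < p - 1 by linarith)).1
    refine lt_of_le_of_lt ?_ h.lintegral_lt_top
    exact setLIntegral_mono' measurableSet_Ioc fun t ht => mul_le_of_le_one_left' prob_le_one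
  · have h := (integrableOn_Ioi_rpow_of_lt (a := p - 1 - β) (c := 1) (by linarith)
      zero_lt_one).const_mul (K * (x₀ ^ β + x₀ ^ γ))
    refine lt_of_le_of_lt ?_ h.lintegral_lt_top
    refine setLIntegral_mono' measurableSet_Ioi fun t ht => ?_
    have ht1 : (1 : ℝ) < t := ht
    have ht0 : 0 < t := by linarith
    rw [← ofReal_measureReal, ← ENNReal.ofReal_mul measureReal_nonneg]
    refine ENNReal.ofReal_le_ofReal ?_
    -- at the fixed point `x₀`, the scale `c = x₀ / t` gives a bound on the tail at `t`
    have h1 := hb x₀ le_rfl (x₀ / t) (by positivity)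
    rw [show x₀ / (x₀ / t) = t by field_simp] at h1
    rw [sub_eq_add_neg (p - 1), Real.rpow_add ht0, mul_comm (t ^ (p - 1)), ← mul_assoc]
    refine mul_le_mul_of_nonneg_right ?_ (by positivity)
    have h2 : P.real {ω | V ω > x₀} ≤ 1 := measureReal_le_one
    have h3 : t ^ (-γ) ≤ t ^ (-β) := Real.rpow_le_rpow_of_exponent_le ht1.le (by linarith)
    have p1 := Real.rpow_pos_of_pos hx₀ β
    have p2 := Real.rpow_pos_of_pos hx₀ γ
    have p3 := Real.rpow_pos_of_pos ht0 (-β)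
    rw [Real.div_rpow hx₀.le ht0.le, Real.div_rpow hx₀.le ht0.le, div_eq_mul_inv, div_eq_mul_inv,
          ← Real.rpow_neg ht0.le, ← Real.rpow_neg ht0.le] at h1
    calc P.real {ω | t < V ω} ≤ K * (x₀ ^ β * t ^ (-β) + x₀ ^ γ * t ^ (-γ)) * 1 :=
          h1.trans (mul_le_mul_of_nonneg_left h2 (by positivity))
      _ ≤ K * (x₀ ^ β * t ^ (-β) + x₀ ^ γ * t ^ (-β)) * 1 := by gcongr
      _ = _ := by ring

end Tail

/-! ### Convex functions with a controlled Taylor remainder -/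

/-- If the oscillation of the derivative `ψ` of `φ` over distances at most `|b|` is at most `h`, then
the first-order Taylor remainder of `φ` is at most `h |b|`. -/
theorem taylor_le_of_oscillation {φ ψ : ℝ → ℝ} (hφ : ∀ x, HasDerivAt φ (ψ x) x) {a b h : ℝ}
    (hψ : ∀ x, |x - a| ≤ |b| → |ψ x - ψ a| ≤ h) : φ (a + b) ≤ φ a + ψ a * b + h * |b| := by
  have hd : ∀ x ∈ Set.uIcc a (a + b),
      HasDerivWithinAt (fun t => φ t - ψ a * t) (ψ x - ψ a) (Set.uIcc a (a + b)) x := fun x _ => by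
    have := ((hφ x).sub ((hasDerivAt_id x).const_mul (ψ a))).hasDerivWithinAt (s := Set.uIcc a (a + b))
    rw [mul_one] at this
    exact this
  have hb : ∀ x ∈ Set.uIcc a (a + b), ‖ψ x - ψ a‖ ≤ h := fun x hx => by
    refine hψ x ?_
    have := Set.abs_sub_left_of_mem_uIcc hx
    simpa using this
  have := (convex_uIcc a (a + b)).norm_image_sub_le_of_norm_hasDerivWithin_le hd hb
    Set.left_mem_uIcc Set.right_mem_uIcc
  rw [Real.norm_eq_abs, Real.norm_eq_abs] at this
  have h2 := (le_abs_self _).trans this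
  simp only [add_sub_cancel_left] at h2
  linarith

/-- The smooth convex function `√(1 + b ^ 2) - 1`, quadratic near the origin and linear far away. -/
noncomputable def pseudoHuber (b : ℝ) : ℝ := √(1 + b ^ 2) - 1

/-- The derivative of `pseudoHuber`. -/
noncomputable def pseudoHuberDeriv (b : ℝ) : ℝ := b / √(1 + b ^ 2)

theorem hasDerivAt_sqrt_one_add_sq (b : ℝ) :
    HasDerivAt (fun b : ℝ => √(1 + b ^ 2)) (b / √(1 + b ^ 2)) b := by
  have h1 : HasDerivAt (fun b : ℝ => 1 + b ^ 2) (2 * b) b := by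
    simpa using (hasDerivAt_pow 2 b).const_add 1
  have h2 := h1.sqrt (by positivity)
  rwa [mul_div_mul_left _ _ two_ne_zero] at h2

theorem hasDerivAt_pseudoHuber (b : ℝ) : HasDerivAt pseudoHuber (pseudoHuberDeriv b) b :=
  (hasDerivAt_sqrt_one_add_sq b).sub_const 1

theorem abs_pseudoHuberDeriv_le (b : ℝ) : |pseudoHuberDeriv b| ≤ 1 := by
  have h : 0 < √(1 + b ^ 2) := Real.sqrt_pos.2 (by positivity)
  rw [pseudoHuberDeriv, abs_div, abs_of_pos h, div_le_one h]
  exact Real.abs_le_sqrt (by linarith)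

theorem abs_pseudoHuberDeriv_sub_le (a b : ℝ) :
    |pseudoHuberDeriv a - pseudoHuberDeriv b| ≤ |a - b| := by
  have hd : ∀ x ∈ (Set.univ : Set ℝ), HasDerivWithinAt pseudoHuberDeriv
      ((1 * √(1 + x ^ 2) - x * (x / √(1 + x ^ 2))) / √(1 + x ^ 2) ^ 2) Set.univ x := fun x _ =>
    ((hasDerivAt_id x).div (hasDerivAt_sqrt_one_add_sq x)
      (Real.sqrt_pos.2 (by positivity)).ne').hasDerivWithinAt
  have hb : ∀ x ∈ (Set.univ : Set ℝ),
      ‖(1 * √(1 + x ^ 2) - x * (x / √(1 + x ^ 2))) / √(1 + x ^ 2) ^ 2‖ ≤ 1 := fun x _ => by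
    have h : 1 ≤ √(1 + x ^ 2) := Real.one_le_sqrt.2 (by nlinarith [sq_nonneg x])
    have h2 : √(1 + x ^ 2) ^ 2 = 1 + x ^ 2 := Real.sq_sqrt (by positivity)
    have e : (1 * √(1 + x ^ 2) - x * (x / √(1 + x ^ 2))) / √(1 + x ^ 2) ^ 2
        = 1 / √(1 + x ^ 2) ^ 3 := by
      have h0 : √(1 + x ^ 2) ≠ 0 := by positivity
      field_simp
      rw [h2]; ring
    rw [e, Real.norm_eq_abs, abs_of_nonneg (by positivity), div_le_one (by positivity)]
    exact one_le_pow₀ h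
  simpa using convex_univ.norm_image_sub_le_of_norm_hasDerivWithin_le hd hb
    (Set.mem_univ b) (Set.mem_univ a)

theorem pseudoHuber_add_le (a b : ℝ) :
    pseudoHuber (a + b) ≤ pseudoHuber a + pseudoHuberDeriv a * b + quadLin b := by
  have h1 := taylor_le_of_oscillation (a := a) (b := b) (h := |b|) hasDerivAt_pseudoHuber
    fun x hx => (abs_pseudoHuberDeriv_sub_le x a).trans hx
  have h2 := taylor_le_of_oscillation (a := a) (b := b) (h := 2) hasDerivAt_pseudoHuber
    fun x _ => (abs_sub _ _).trans (by
      linarith [abs_pseudoHuberDeriv_le x, abs_pseudoHuberDeriv_le a])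
  rw [abs_mul_abs_self] at h1
  unfold quadLin
  rcases min_choice (b ^ 2) |b| with h | h <;> rw [h] <;> nlinarith [sq_nonneg b]

theorem pseudoHuber_nonneg (b : ℝ) : 0 ≤ pseudoHuber b := by
  have h : 1 ≤ √(1 + b ^ 2) := Real.one_le_sqrt.2 (by nlinarith [sq_nonneg b])
  unfold pseudoHuber; linarith

theorem pseudoHuber_zero : pseudoHuber 0 = 0 := by simp [pseudoHuber]

theorem one_le_three_mul_pseudoHuber {b : ℝ} (h : 1 ≤ |b|) : 1 ≤ 3 * pseudoHuber b := by
  have h1 : 4 / 3 ≤ √(1 + b ^ 2) := by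
    apply Real.le_sqrt_of_sq_le
    rw [← sq_abs b]; nlinarith
  unfold pseudoHuber; linarith

theorem pseudoHuber_le_abs (b : ℝ) : pseudoHuber b ≤ |b| := by
  have : √(1 + b ^ 2) ≤ 1 + |b| := by
    apply Real.sqrt_le_iff.2 ⟨by positivity, ?_⟩
    rw [← sq_abs b]; nlinarith [abs_nonneg b]
  unfold pseudoHuber; linarith

theorem continuous_pseudoHuber : Continuous pseudoHuber := by unfold pseudoHuber; fun_prop

theorem measurable_pseudoHuberDeriv : Measurable pseudoHuberDeriv := by
  unfold pseudoHuberDeriv; fun_prop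

theorem rpow_sub_rpow_le {x y q : ℝ} (hy : 0 ≤ y) (hxy : y ≤ x) (h0 : 0 ≤ q) (h1 : q ≤ 1) :
    x ^ q - y ^ q ≤ (x - y) ^ q := by
  have := Real.rpow_add_le_add_rpow (sub_nonneg.2 hxy) hy h0 h1
  rw [sub_add_cancel] at this
  linarith

/-- The derivative `p |x| ^ (p - 2) x` of `|x| ^ p` is `(p - 1)`-Hölder continuous. -/
theorem abs_rpow_mul_sub_le {p : ℝ} (h1 : 1 < p) (h2 : p ≤ 2) (x y : ℝ) :
    |p * |x| ^ (p - 2) * x - p * |y| ^ (p - 2) * y| ≤ 4 * |x - y| ^ (p - 1) := by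
  have hpos : ∀ z : ℝ, 0 ≤ z → |z| ^ (p - 2) * z = z ^ (p - 1) := by
    intro z hz
    rcases hz.eq_or_lt with h | h
    · rw [← h]; simp [Real.zero_rpow (show p - 1 ≠ 0 by linarith)]
    · rw [abs_of_nonneg hz]
      nth_rw 2 [← Real.rpow_one z]
      rw [← Real.rpow_add h]; congr 1; ring
  have hneg : ∀ z : ℝ, z ≤ 0 → |z| ^ (p - 2) * z = -(-z) ^ (p - 1) := by
    intro z hz
    have := hpos (-z) (by linarith)
    rw [abs_neg] at this
    linarith
  have hq0 : 0 ≤ p - 1 := by linarith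
  have hq1 : p - 1 ≤ 1 := by linarith
  have key : ∀ x y : ℝ, y ≤ x → |(|x| ^ (p - 2) * x - |y| ^ (p - 2) * y)| ≤ 2 * |x - y| ^ (p - 1) := by
    intro x y hxy
    rw [abs_of_nonneg (sub_nonneg.2 hxy)]
    have hd : 0 ≤ (x - y) ^ (p - 1) := Real.rpow_nonneg (sub_nonneg.2 hxy) _
    rcases le_total 0 y with hy | hy
    · rw [hpos x (hy.trans hxy), hpos y hy, abs_of_nonneg]
      · linarith [rpow_sub_rpow_le hy hxy hq0 hq1]
      · exact sub_nonneg.2 (Real.rpow_le_rpow hy hxy hq0)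
    · rcases le_total 0 x with hx | hx
      · rw [hpos x hx, hneg y hy, sub_neg_eq_add, abs_of_nonneg]
        · have e1 := Real.rpow_le_rpow hx (show x ≤ x - y by linarith) hq0
          have e2 := Real.rpow_le_rpow (neg_nonneg.2 hy) (show -y ≤ x - y by linarith) hq0
          linarith
        · exact add_nonneg (Real.rpow_nonneg hx _) (Real.rpow_nonneg (neg_nonneg.2 hy) _)
      · rw [hneg x hx, hneg y hy, abs_of_nonneg]
        · have := rpow_sub_rpow_le (neg_nonneg.2 hx) (neg_le_neg hxy) hq0 hq1
          rw [show -y - -x = x - y by ring] at this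
          linarith
        · have := Real.rpow_le_rpow (neg_nonneg.2 hx) (neg_le_neg hxy) hq0
          linarith
  have key2 : |(|x| ^ (p - 2) * x - |y| ^ (p - 2) * y)| ≤ 2 * |x - y| ^ (p - 1) := by
    rcases le_total y x with h | h
    · exact key x y h
    · rw [abs_sub_comm, abs_sub_comm x y]; exact key y x h
  have hd : 0 ≤ |x - y| ^ (p - 1) := Real.rpow_nonneg (abs_nonneg _) _
  rw [mul_assoc, mul_assoc, ← mul_sub, abs_mul, abs_of_pos (by linarith)]
  nlinarith [abs_nonneg (|x| ^ (p - 2) * x - |y| ^ (p - 2) * y)]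

/-- The Taylor bound for `|x| ^ p`. -/
theorem abs_add_rpow_le {p : ℝ} (h1 : 1 < p) (h2 : p ≤ 2) (a b : ℝ) :
    |a + b| ^ p ≤ |a| ^ p + p * |a| ^ (p - 2) * a * b + 4 * |b| ^ p := by
  have := taylor_le_of_oscillation (φ := fun x : ℝ => |x| ^ p) (ψ := fun x => p * |x| ^ (p - 2) * x)
    (a := a) (b := b) (h := 4 * |b| ^ (p - 1)) (fun x => hasDerivAt_abs_rpow x h1)
    fun x hx => (abs_rpow_mul_sub_le h1 h2 x a).trans (by
      gcongr)
  refine this.trans (le_of_eq ?_)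
  have e : |b| ^ (p - 1) * |b| = |b| ^ p := by
    rcases (abs_nonneg b).eq_or_lt with h | h
    · rw [← h]; simp [Real.zero_rpow (show p ≠ 0 by linarith)]
    · nth_rw 2 [← Real.rpow_one |b|]
      rw [← Real.rpow_add h]; congr 1; ring
  rw [mul_assoc 4, e]

/-! ### Tails of sums: the principle of a single big jump -/

section BigJump

variable {Ω : Type*} [MeasurableSpace Ω] {P : Measure Ω} {F : ℝ → ℝ} {α : ℝ}

/-- A function asymptotic to a multiple of `F` has the same behaviour under scaling as `F`. -/
theorem IsRegVar.tendsto_comp_mul (hF : IsRegVar F α) (hpos : ∀ x, 0 < F x) {T : ℝ → ℝ} {a r : ℝ}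
    (hr : 0 < r) (h : Tendsto (fun x => T x / F x) atTop (𝓝 a)) :
    Tendsto (fun x => T (r * x) / F x) atTop (𝓝 (a * r ^ (-α))) := by
  refine ((h.comp (tendsto_id.const_mul_atTop hr)).mul (hF r hr)).congr fun x => ?_
  have := (hpos (r * x)).ne'
  simp only [Function.comp, id]
  field_simp

theorem tendsto_mul_one_add_rpow (b α : ℝ) :
    Tendsto (fun ε : ℝ => b * (1 + ε) ^ (-α)) (𝓝 0) (𝓝 b) := by
  have : ContinuousAt (fun ε : ℝ => b * (1 + ε) ^ (-α)) 0 := by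
    refine continuousAt_const.mul (ContinuousAt.rpow_const (by fun_prop) (Or.inl (by norm_num)))
  simpa [ContinuousAt] using this

theorem exists_lt_mul_one_add_rpow {l b : ℝ} (α : ℝ) (h : l < b) :
    ∃ ε : ℝ, 0 < ε ∧ ε < 1 ∧ l < b * (1 + ε) ^ (-α) := by
  have h1 := ((tendsto_mul_one_add_rpow b α).mono_left (nhdsWithin_le_nhds (s := Set.Ioi 0))).eventually
    (lt_mem_nhds h)
  obtain ⟨ε, h2, h3⟩ := (h1.and (Ioo_mem_nhdsGT zero_lt_one)).exists
  exact ⟨ε, h3.1, h3.2, h2⟩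

theorem exists_mul_one_sub_rpow_lt {u b : ℝ} (α : ℝ) (h : b < u) :
    ∃ ε : ℝ, 0 < ε ∧ ε < 1 ∧ b * (1 - ε) ^ (-α) < u := by
  have h0 : Tendsto (fun ε : ℝ => -ε) (𝓝[>] 0) (𝓝 0) := by
    have : Tendsto (fun ε : ℝ => -ε) (𝓝 0) (𝓝 (-0)) := tendsto_id.neg
    rw [neg_zero] at this
    exact this.mono_left nhdsWithin_le_nhds
  have h1 := ((tendsto_mul_one_add_rpow b α).comp h0).eventually (gt_mem_nhds h)
  obtain ⟨ε, h2, h3⟩ := (h1.and (Ioo_mem_nhdsGT zero_lt_one)).exists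
  exact ⟨ε, h3.1, h3.2, by simpa [sub_eq_add_neg] using h2⟩

/-- The tail constants of two random variables add up if it is unlikely that both are large. -/
theorem tendsto_tail_add [IsFiniteMeasure P] (hF : IsRegVar F α) (hpos : ∀ x, 0 < F x)
    {A B : Ω → ℝ} (hAm : Measurable A) (hBm : Measurable B) {a b : ℝ}
    (hA : Tendsto (fun x => P.real {ω | A ω > x} / F x) atTop (𝓝 a))
    (hB : Tendsto (fun x => P.real {ω | B ω > x} / F x) atTop (𝓝 b))
    (hAB : ∀ ε : ℝ, 0 < ε →
      Tendsto (fun x => P.real {ω | ε * x < |A ω| ∧ ε * x < |B ω|} / F x) atTop (𝓝 0)) :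
    Tendsto (fun x => P.real {ω | A ω + B ω > x} / F x) atTop (𝓝 (a + b)) := by
  refine tendsto_order.2 ⟨fun l hl => ?_, fun u hu => ?_⟩
  · obtain ⟨ε, h0, h1, h2⟩ := exists_lt_mul_one_add_rpow α hl
    have hlim := ((hF.tendsto_comp_mul hpos (show 0 < 1 + ε by linarith) hA).add
      (hF.tendsto_comp_mul hpos (show 0 < 1 + ε by linarith) hB)).sub ((hAB ε h0).const_mul 2)
    rw [← add_mul, mul_zero, sub_zero] at hlim
    filter_upwards [hlim.eventually (lt_mem_nhds h2), eventually_gt_atTop 0] with x hx hx0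
    refine hx.trans_le ?_
    rw [← add_div, ← mul_div_assoc, ← sub_div]
    refine div_le_div_of_nonneg_right ?_ (hpos x).le
    set J := {ω | ε * x < |A ω| ∧ ε * x < |B ω|} with hJ
    have hεx : 0 < ε * x := by positivity
    have e1 : P.real {ω | A ω > (1 + ε) * x} ≤
        P.real {ω | A ω > (1 + ε) * x ∧ |B ω| ≤ ε * x} + P.real J := by
      refine (measureReal_mono ?_).trans (measureReal_union_le _ _)
      intro ω (hω : A ω > (1 + ε) * x)
      rcases le_or_gt |B ω| (ε * x) with h | h
      · exact Or.inl ⟨hω, h⟩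
      · exact Or.inr ⟨lt_of_lt_of_le (by linarith) (le_abs_self _), h⟩
    have e2 : P.real {ω | B ω > (1 + ε) * x} ≤
        P.real {ω | B ω > (1 + ε) * x ∧ |A ω| ≤ ε * x} + P.real J := by
      refine (measureReal_mono ?_).trans (measureReal_union_le _ _)
      intro ω (hω : B ω > (1 + ε) * x)
      rcases le_or_gt |A ω| (ε * x) with h | h
      · exact Or.inl ⟨hω, h⟩
      · exact Or.inr ⟨h, lt_of_lt_of_le (by linarith) (le_abs_self _)⟩
    have e3 : P.real {ω | A ω > (1 + ε) * x ∧ |B ω| ≤ ε * x} +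
        P.real {ω | B ω > (1 + ε) * x ∧ |A ω| ≤ ε * x} ≤ P.real {ω | A ω + B ω > x} := by
      rw [← measureReal_union]
      · refine measureReal_mono ?_
        rintro ω (⟨h, h'⟩ | ⟨h, h'⟩)
        · have := (abs_le.1 h').1
          show A ω + B ω > x
          linarith
        · have := (abs_le.1 h').1
          show A ω + B ω > x
          linarith
      · refine Set.disjoint_left.2 ?_
        rintro ω ⟨h, -⟩ ⟨-, h'⟩
        have := (abs_le.1 h').2
        linarith
      · exact (measurableSet_lt measurable_const hBm).inter
          (measurableSet_le hAm.abs measurable_const)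
    linarith
  · obtain ⟨ε, h0, h1, h2⟩ := exists_mul_one_sub_rpow_lt α hu
    have hlim := ((hF.tendsto_comp_mul hpos (show 0 < 1 - ε by linarith) hA).add
      (hF.tendsto_comp_mul hpos (show 0 < 1 - ε by linarith) hB)).add (hAB ε h0)
    rw [← add_mul, add_zero] at hlim
    filter_upwards [hlim.eventually (gt_mem_nhds h2), eventually_gt_atTop 0] with x hx hx0
    refine lt_of_le_of_lt ?_ hx
    rw [← add_div, ← add_div]
    refine div_le_div_of_nonneg_right ?_ (hpos x).le
    refine (measureReal_mono (s₂ := ({ω | A ω > (1 - ε) * x} ∪ {ω | B ω > (1 - ε) * x}) ∪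
      {ω | ε * x < |A ω| ∧ ε * x < |B ω|}) ?_).trans
      ((measureReal_union_le _ _).trans (by gcongr; exact measureReal_union_le _ _))
    intro ω (hω : A ω + B ω > x)
    by_contra hcon
    simp only [Set.mem_union, Set.mem_ofPred_eq, not_or, gt_iff_lt, not_lt, not_and] at hcon
    obtain ⟨⟨c1, c2⟩, c3⟩ := hcon
    have := (le_abs_self (B ω)).trans (c3 (lt_of_lt_of_le (by linarith) (le_abs_self _)))
    linarith

/-- A tail asymptotic passes to the limit of approximations whose error has a tail that is
eventually a small multiple of `F`. -/
theorem tendsto_tail_of_approx [IsFiniteMeasure P] (hF : IsRegVar F α) (hpos : ∀ x, 0 < F x)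
    {ι : Type*} {L : Filter ι} [L.NeBot] {M : ι → Ω → ℝ} {R : Ω → ℝ} {b δ : ι → ℝ} {b₀ : ℝ}
    (hM : ∀ i, Tendsto (fun x => P.real {ω | M i ω > x} / F x) atTop (𝓝 (b i)))
    (hb : Tendsto b L (𝓝 b₀)) (hδ : Tendsto δ L (𝓝 0))
    (hR : ∀ i, ∀ᶠ x in atTop, P.real {ω | x ≤ |R ω - M i ω|} ≤ δ i * F x) :
    Tendsto (fun x => P.real {ω | R ω > x} / F x) atTop (𝓝 b₀) := by
  refine tendsto_order.2 ⟨fun l hl => ?_, fun u hu => ?_⟩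
  · obtain ⟨ε, h0, h1, h2⟩ := exists_lt_mul_one_add_rpow α hl
    have hlim := (hb.mul_const ((1 + ε) ^ (-α))).sub (hδ.mul_const (ε ^ (-α)))
    rw [zero_mul, sub_zero] at hlim
    obtain ⟨i, hi⟩ := (hlim.eventually (lt_mem_nhds h2)).exists
    have h3 := (hF.tendsto_comp_mul hpos (show 0 < 1 + ε by linarith) (hM i)).sub
      ((hF ε h0).const_mul (δ i))
    filter_upwards [h3.eventually (lt_mem_nhds hi),
      (tendsto_id.const_mul_atTop h0).eventually (hR i)] with x hx hx2
    refine hx.trans_le ?_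
    rw [← mul_div_assoc, ← sub_div]
    refine div_le_div_of_nonneg_right ?_ (hpos x).le
    have e1 : P.real {ω | M i ω > (1 + ε) * x} ≤
        P.real {ω | R ω > x} + P.real {ω | ε * x ≤ |R ω - M i ω|} := by
      refine (measureReal_mono ?_).trans (measureReal_union_le _ _)
      intro ω (hω : M i ω > (1 + ε) * x)
      rcases lt_or_ge x (R ω) with h | h
      · exact Or.inl h
      · refine Or.inr ?_
        show ε * x ≤ |R ω - M i ω|
        rw [abs_sub_comm]
        exact le_trans (by linarith) (le_abs_self _)
    simp only [id] at hx2
    linarith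
  · obtain ⟨ε, h0, h1, h2⟩ := exists_mul_one_sub_rpow_lt α hu
    have hlim := (hb.mul_const ((1 - ε) ^ (-α))).add (hδ.mul_const (ε ^ (-α)))
    rw [zero_mul, add_zero] at hlim
    obtain ⟨i, hi⟩ := (hlim.eventually (gt_mem_nhds h2)).exists
    have h3 := (hF.tendsto_comp_mul hpos (show 0 < 1 - ε by linarith) (hM i)).add
      ((hF ε h0).const_mul (δ i))
    filter_upwards [h3.eventually (gt_mem_nhds hi),
      (tendsto_id.const_mul_atTop h0).eventually (hR i)] with x hx hx2
    refine lt_of_le_of_lt ?_ hx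
    rw [← mul_div_assoc, ← add_div]
    refine div_le_div_of_nonneg_right ?_ (hpos x).le
    have e1 : P.real {ω | R ω > x} ≤
        P.real {ω | M i ω > (1 - ε) * x} + P.real {ω | ε * x ≤ |R ω - M i ω|} := by
      refine (measureReal_mono ?_).trans (measureReal_union_le _ _)
      intro ω (hω : R ω > x)
      rcases lt_or_ge ((1 - ε) * x) (M i ω) with h | h
      · exact Or.inl h
      · refine Or.inr ?_
        show ε * x ≤ |R ω - M i ω|
        exact le_trans (by linarith) (le_abs_self _)
    simp only [id] at hx2
    linarith

/-- Disintegration of the joint law of independent random variables, without reference to laws. -/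
theorem measureReal_eq_integral_of_indepFun [IsProbabilityMeasure P] {E : Type*}
    [MeasurableSpace E] {Z : Ω → E} {Y : Ω → ℝ} (hZ : Measurable Z) (hY : Measurable Y)
    (h : IndepFun Z Y P) {S : Set (E × ℝ)} (hS : MeasurableSet S) :
    P.real {ω | (Z ω, Y ω) ∈ S} = ∫ ω, P.real {ω' | (Z ω, Y ω') ∈ S} ∂P := by
  have e0 : ∀ z, P {ω' | (z, Y ω') ∈ S} = P.map Y (Prod.mk z ⁻¹' S) := fun z => by
    rw [Measure.map_apply hY (measurable_prodMk_left hS)]; rfl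
  have e1 : P {ω | (Z ω, Y ω) ∈ S} = ∫⁻ ω, P {ω' | (Z ω, Y ω') ∈ S} ∂P := by
    have hprod := (indepFun_iff_map_prod_eq_prod_map_map hZ.aemeasurable hY.aemeasurable).1 h
    have e2 : P {ω | (Z ω, Y ω) ∈ S} = P.map (fun ω => (Z ω, Y ω)) S := by
      rw [Measure.map_apply (hZ.prodMk hY) hS]; rfl
    have := Measure.isProbabilityMeasure_map (μ := P) hY.aemeasurable
    rw [e2, hprod, Measure.prod_apply hS, lintegral_map (measurable_measure_prodMk_left hS) hZ]
    simp_rw [e0]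
  have hm : Measurable fun ω => P {ω' | (Z ω, Y ω') ∈ S} := by
    simp_rw [e0]
    have := Measure.isProbabilityMeasure_map (μ := P) hY.aemeasurable
    exact (measurable_measure_prodMk_left hS).comp hZ
  simp only [measureReal_def, e1]
  rw [integral_toReal hm.aemeasurable]
  exact Eventually.of_forall fun ω => measure_lt_top _ _

/-- The term `c Y` to be added to the sum `M`: the fluctuation `Y ≥ -1` is independent of the pair of
`M` and `c`, `F` is the tail of `Y + 1`, and `G` controls the tails of all multiples `r Y` relative
to `F`, uniformly in `r`. -/
structure IsBigJumpTerm (P : Measure Ω) (F G : ℝ → ℝ) (M c Y : Ω → ℝ) : Prop where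
  measurable_M : Measurable M
  measurable_c : Measurable c
  measurable_Y : Measurable Y
  indep : IndepFun (fun ω => (M ω, c ω)) Y P
  neg_one_le : ∀ ω, -1 ≤ Y ω
  tail : ∀ x, P.real {ω | Y ω + 1 > x} = F x
  integrable : Integrable (fun ω => G (c ω)) P
  bound : ∀ᶠ x in atTop, ∀ r : ℝ, P.real {ω | x ≤ |r * Y ω|} ≤ G r * F x

variable {G : ℝ → ℝ} {M c Y : Ω → ℝ}

/-- A version of Breiman's lemma. -/
theorem IsBigJumpTerm.tendsto_tail_mul [IsProbabilityMeasure P] (h : IsBigJumpTerm P F G M c Y)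
    (hF : IsRegVar F α) (hpos : ∀ x, 0 < F x) (hα : 0 < α) :
    Tendsto (fun x => P.real {ω | c ω * Y ω > x} / F x) atTop
      (𝓝 (∫ ω, (max (c ω) 0) ^ α ∂P)) := by
  have hanti : Antitone F := fun x y hxy => by
    rw [← h.tail, ← h.tail]
    exact measureReal_mono fun ω (hω : Y ω + 1 > y) => lt_of_le_of_lt hxy hω
  have hS : ∀ x : ℝ, MeasurableSet {q : (ℝ × ℝ) × ℝ | q.1.2 * q.2 > x} := fun x =>
    measurableSet_lt measurable_const (by fun_prop)
  have e : ∀ x, P.real {ω | c ω * Y ω > x} = ∫ ω, P.real {ω' | c ω * Y ω' > x} ∂P := fun x =>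
    measureReal_eq_integral_of_indepFun (h.measurable_M.prodMk h.measurable_c) h.measurable_Y
      h.indep (hS x)
  simp_rw [e, ← integral_div]
  refine tendsto_integral_filter_of_dominated_convergence (fun ω => G (c ω)) ?_ ?_ h.integrable ?_
  · refine Eventually.of_forall fun x => Measurable.aestronglyMeasurable ?_
    have hm : Measurable fun r : ℝ => P {ω' | r * Y ω' > x} := by
      have : MeasurableSet {q : ℝ × Ω | q.1 * Y q.2 > x} :=
        measurableSet_lt measurable_const (measurable_fst.mul (h.measurable_Y.comp measurable_snd))
      exact measurable_measure_prodMk_left this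
    exact ((hm.comp h.measurable_c).ennreal_toReal).div_const _
  · filter_upwards [h.bound] with x hx
    refine Eventually.of_forall fun ω => ?_
    rw [Real.norm_eq_abs, abs_of_nonneg (div_nonneg measureReal_nonneg (hpos x).le),
      div_le_iff₀ (hpos x)]
    refine (measureReal_mono ?_).trans (hx (c ω))
    intro ω' (hω' : c ω * Y ω' > x)
    exact hω'.le.trans (le_abs_self _)
  · refine Eventually.of_forall fun ω => ?_
    rcases lt_trichotomy (c ω) 0 with hc | hc | hc
    · -- `c Y ≤ |c|` because `Y ≥ -1`
      rw [max_eq_right hc.le, Real.zero_rpow hα.ne']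
      refine tendsto_const_nhds.congr' ?_
      filter_upwards [eventually_ge_atTop (-c ω)] with x hx
      have : {ω' | c ω * Y ω' > x} = ∅ := by
        refine Set.eq_empty_of_forall_notMem fun ω' (hω' : c ω * Y ω' > x) => ?_
        nlinarith [h.neg_one_le ω']
      simp [this]
    · rw [hc, max_self, Real.zero_rpow hα.ne']
      refine tendsto_const_nhds.congr' ?_
      filter_upwards [eventually_ge_atTop 0] with x hx
      have : {ω' | 0 * Y ω' > x} = ∅ := by
        refine Set.eq_empty_of_forall_notMem fun ω' (hω' : 0 * Y ω' > x) => ?_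
        rw [zero_mul] at hω'; linarith
      rw [this, measureReal_empty, zero_div]
    · rw [max_eq_left hc.le]
      have e1 : ∀ x, P.real {ω' | c ω * Y ω' > x} = F (x / c ω + 1) := fun x => by
        rw [← h.tail]
        congr 1; ext ω'
        simp only [Set.mem_ofPred_eq, gt_iff_lt, add_lt_add_iff_right, div_lt_iff₀ hc, mul_comm]
      simp_rw [e1]
      have e2 : (c ω)⁻¹ ^ (-α) = c ω ^ α := by
        rw [Real.inv_rpow hc.le, Real.rpow_neg hc.le, inv_inv]
      refine tendsto_order.2 ⟨fun l hl => ?_, fun u hu => ?_⟩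
      · obtain ⟨ε, h0, -, h2⟩ := exists_lt_mul_one_add_rpow α hl
        have h3 := hF ((c ω)⁻¹ * (1 + ε)) (by positivity)
        rw [Real.mul_rpow (by positivity) (by positivity), e2] at h3
        filter_upwards [h3.eventually (lt_mem_nhds h2),
          eventually_ge_atTop (c ω / ε)] with x hx hx1
        refine hx.trans_le (div_le_div_of_nonneg_right (hanti ?_) (hpos x).le)
        have : 1 ≤ (c ω)⁻¹ * ε * x := by
          rw [div_le_iff₀ h0] at hx1
          rw [mul_assoc, inv_mul_eq_div, one_le_div hc]; linarith
        rw [div_eq_inv_mul]; linarith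
      · have h3 := hF (c ω)⁻¹ (by positivity)
        rw [e2] at h3
        filter_upwards [h3.eventually (gt_mem_nhds hu)] with x hx
        refine lt_of_le_of_lt (div_le_div_of_nonneg_right (hanti ?_) (hpos x).le) hx
        rw [div_eq_inv_mul]; linarith

/-- The sum of the earlier terms and the new term are both large only with negligible probability:
given that `M` is large, `c Y` is still large with conditional probability of order `F`. -/
theorem IsBigJumpTerm.tendsto_joint [IsProbabilityMeasure P] (h : IsBigJumpTerm P F G M c Y)
    (hF : IsRegVar F α) (hpos : ∀ x, 0 < F x) {ε : ℝ} (hε : 0 < ε) :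
    Tendsto (fun x => P.real {ω | ε * x < |M ω| ∧ ε * x < |c ω * Y ω|} / F x) atTop (𝓝 0) := by
  have hS : ∀ x : ℝ, MeasurableSet {q : (ℝ × ℝ) × ℝ | ε * x < |q.1.1| ∧ ε * x < |q.1.2 * q.2|} :=
    fun x => by
      have h1 : MeasurableSet {q : (ℝ × ℝ) × ℝ | ε * x < |q.1.1|} :=
        measurableSet_lt measurable_const (by fun_prop)
      have h2 : MeasurableSet {q : (ℝ × ℝ) × ℝ | ε * x < |q.1.2 * q.2|} :=
        measurableSet_lt measurable_const (by fun_prop)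
      exact h1.inter h2
  have e : ∀ x, P.real {ω | ε * x < |M ω| ∧ ε * x < |c ω * Y ω|} =
      ∫ ω, P.real {ω' | ε * x < |M ω| ∧ ε * x < |c ω * Y ω'|} ∂P := fun x =>
    measureReal_eq_integral_of_indepFun (h.measurable_M.prodMk h.measurable_c) h.measurable_Y
      h.indep (hS x)
  have hbd : ∀ᶠ x in atTop, F (ε * x) / F x ≤ ε ^ (-α) + 1 :=
    ((hF ε hε).eventually (gt_mem_nhds (lt_add_one _))).mono fun x hx => hx.le
  have hεx : Tendsto (fun x : ℝ => ε * x) atTop atTop := tendsto_id.const_mul_atTop hε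
  simp_rw [e, ← integral_div]
  rw [← integral_zero Ω ℝ (μ := P)]
  refine tendsto_integral_filter_of_dominated_convergence
    (fun ω => (ε ^ (-α) + 1) * G (c ω)) ?_ ?_ (h.integrable.const_mul _) ?_
  · refine Eventually.of_forall fun x => Measurable.aestronglyMeasurable ?_
    have hm : Measurable fun q : ℝ × ℝ => P {ω' | ε * x < |q.1| ∧ ε * x < |q.2 * Y ω'|} := by
      have : MeasurableSet {q : (ℝ × ℝ) × Ω | ε * x < |q.1.1| ∧ ε * x < |q.1.2 * Y q.2|} := by
        have h1 : MeasurableSet {q : (ℝ × ℝ) × Ω | ε * x < |q.1.1|} :=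
          measurableSet_lt measurable_const (by fun_prop)
        have h2 : MeasurableSet {q : (ℝ × ℝ) × Ω | ε * x < |q.1.2 * Y q.2|} :=
          measurableSet_lt measurable_const (measurable_fst.snd.mul
            (h.measurable_Y.comp measurable_snd)).abs
        exact h1.inter h2
      exact measurable_measure_prodMk_left this
    exact ((hm.comp (h.measurable_M.prodMk h.measurable_c)).ennreal_toReal).div_const _
  · filter_upwards [hεx.eventually h.bound, hbd] with x hx hx2
    refine Eventually.of_forall fun ω => ?_
    rw [Real.norm_eq_abs, abs_of_nonneg (div_nonneg measureReal_nonneg (hpos x).le),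
      div_le_iff₀ (hpos x)]
    have h1 : P.real {ω' | ε * x < |M ω| ∧ ε * x < |c ω * Y ω'|} ≤ G (c ω) * F (ε * x) :=
      (measureReal_mono fun ω' hω' => hω'.2.le).trans (hx (c ω))
    have hG : 0 ≤ G (c ω) := by
      by_contra hcon
      have := measureReal_nonneg.trans (hx (c ω))
      nlinarith [hpos (ε * x)]
    rw [div_le_iff₀ (hpos x)] at hx2
    refine h1.trans ((mul_le_mul_of_nonneg_left hx2 hG).trans (le_of_eq (by ring)))
  · refine Eventually.of_forall fun ω => ?_
    refine tendsto_const_nhds.congr' ?_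
    filter_upwards [hεx.eventually_ge_atTop |M ω|] with x hx
    have : {ω' | ε * x < |M ω| ∧ ε * x < |c ω * Y ω'|} = ∅ :=
      Set.eq_empty_of_forall_notMem fun ω' hω' => absurd hω'.1 (not_lt.2 hx)
    rw [this, measureReal_empty, zero_div]

theorem IsBigJumpTerm.tendsto_tail_add [IsProbabilityMeasure P] (h : IsBigJumpTerm P F G M c Y)
    (hF : IsRegVar F α) (hpos : ∀ x, 0 < F x) (hα : 0 < α) {a : ℝ}
    (hM : Tendsto (fun x => P.real {ω | M ω > x} / F x) atTop (𝓝 a)) :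
    Tendsto (fun x => P.real {ω | M ω + c ω * Y ω > x} / F x) atTop
      (𝓝 (a + ∫ ω, (max (c ω) 0) ^ α ∂P)) :=
  _root_.tendsto_tail_add hF hpos h.measurable_M (h.measurable_c.mul h.measurable_Y) hM
    (h.tendsto_tail_mul hF hpos hα) fun _ hε => h.tendsto_joint hF hpos hε

end BigJump

/-! ### The branching random walk: line weights and fluctuations -/

/-- Splitting words of length `n + 1` into the last letter and a word of length `n`. -/
theorem tsum_length_succ (f : List ℕ → ℝ≥0∞) (n : ℕ) :
    ∑' u : List ℕ, (if u.length = n + 1 then f u else 0) =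
      ∑' u : List ℕ, (if u.length = n then ∑' j, f (j :: u) else 0) := by
  have hinj : Function.Injective fun q : List ℕ × ℕ => q.2 :: q.1 := by
    rintro ⟨u, j⟩ ⟨v, i⟩ h
    simp only [List.cons.injEq] at h
    simp [h.1, h.2]
  rw [← hinj.tsum_eq, ENNReal.tsum_prod']
  · refine tsum_congr fun u => ?_
    by_cases h : u.length = n <;> simp [h]
  · intro u hu
    cases u with
    | nil => simp at hu
    | cons j u => exact ⟨(u, j), rfl⟩

theorem tsum_length_zero (f : List ℕ → ℝ≥0∞) :
    ∑' u : List ℕ, (if u.length = 0 then f u else 0) = f [] := by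
  rw [tsum_eq_single []]
  · simp
  · intro u hu
    simp [hu]

theorem tsum_eq_tsum_tsum_length (f : List ℕ → ℝ≥0∞) :
    ∑' u, f u = ∑' n : ℕ, ∑' u : List ℕ, (if u.length = n then f u else 0) := by
  rw [ENNReal.tsum_comm]
  refine tsum_congr fun u => ?_
  rw [tsum_eq_single u.length]
  · simp
  · intro n hn
    simp [hn.symm]

namespace BranchingRandomWalk

variable {Ω : Type*} [MeasurableSpace Ω] {P : Measure Ω} (B : BranchingRandomWalk P) (θ : ℝ)

/-- The reproduction data of the individual `u`. -/
def data (u : List ℕ) (ω : Ω) : ℕ∞ × (ℕ → ℝ) := (B.N u ω, fun j => B.X u j ω)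

/-- The normalized weight `e^{-θ X_j} / m(θ)` of the `j`-th child, as a function of the reproduction
data of the parent; it is `0` if there is no such child. -/
noncomputable def childWeight (j : ℕ) (d : ℕ∞ × (ℕ → ℝ)) : ℝ≥0∞ :=
  if (j : ℕ∞) < d.1 then ENNReal.ofReal (Real.exp (-θ * d.2 j)) / B.m θ else 0

/-- The weight `e^{-θ S(u)} / m(θ) ^ |u|` of the individual `u`, or `0` if `u` is not born. -/
noncomputable def lineWeight : List ℕ → Ω → ℝ≥0∞
  | [], _ => 1
  | j :: u, ω => lineWeight u ω * B.childWeight θ j (B.data u ω)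

/-- The total weight of the children of an individual with given reproduction data, relative to the
weight of the individual: the copy of `W_1` rooted at that individual. -/
noncomputable def childMass (d : ℕ∞ × (ℕ → ℝ)) : ℝ≥0∞ := ∑' j, B.childWeight θ j d

/-- The total weight of generation `n`: Biggins' martingale before `toReal`. -/
noncomputable def mass (n : ℕ) (ω : Ω) : ℝ≥0∞ :=
  ∑' u : List ℕ, if u.length = n then B.lineWeight θ u ω else 0

/-- The centred copy of `W_1` rooted at `u`. -/
noncomputable def fluct (u : List ℕ) (ω : Ω) : ℝ := (B.childMass θ (B.data u ω)).toReal - 1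

/-- The normalized moment `k(p) = m(pθ) / m(θ) ^ p`, as a sum over the children of the ancestor. -/
noncomputable def moment (p : ℝ) : ℝ≥0∞ := ∑' j, ∫⁻ ω, B.childWeight θ j (B.data [] ω) ^ p ∂P

theorem measurable_data (u : List ℕ) : Measurable (B.data u) :=
  (B.measurable_N u).prodMk (measurable_pi_lambda _ fun j => B.measurable_X u j)

theorem measurable_childWeight (j : ℕ) : Measurable (B.childWeight θ j) := by
  refine Measurable.ite (measurable_fst (MeasurableSet.of_discrete (s := Set.Ioi (j : ℕ∞)))) ?_ measurable_const
  have : Measurable fun d : ℕ∞ × (ℕ → ℝ) => d.2 j := (measurable_pi_apply j).comp measurable_snd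
  fun_prop

theorem measurable_childMass : Measurable (B.childMass θ) :=
  Measurable.tsum fun j => B.measurable_childWeight θ j

theorem measurable_lineWeight (u : List ℕ) : Measurable (B.lineWeight θ u) := by
  induction u with
  | nil => exact measurable_const
  | cons j u ih => exact ih.mul ((B.measurable_childWeight θ j).comp (B.measurable_data u))

theorem measurable_mass (n : ℕ) : Measurable (B.mass θ n) := by
  refine Measurable.tsum fun u => ?_
  split_ifs
  · exact B.measurable_lineWeight θ u
  · exact measurable_const

theorem measurable_fluct (u : List ℕ) : Measurable (B.fluct θ u) :=
  ((B.measurable_childMass θ).comp (B.measurable_data u)).ennreal_toReal.sub_const 1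

theorem neg_one_le_fluct (u : List ℕ) (ω : Ω) : -1 ≤ B.fluct θ u ω := by
  unfold fluct; linarith [ENNReal.toReal_nonneg (a := B.childMass θ (B.data u ω))]

theorem lintegral_offspring (t : ℝ) (u : List ℕ) (ω : Ω) :
    ∫⁻ x, ENNReal.ofReal (Real.exp (-t * x)) ∂(B.offspring u ω) =
      ∑' j : ℕ, if (j : ℕ∞) < B.N u ω then ENNReal.ofReal (Real.exp (-t * B.X u j ω)) else 0 := by
  have hm : Measurable fun x : ℝ => ENNReal.ofReal (Real.exp (-t * x)) := by fun_prop
  rw [offspring, lintegral_sum_measure]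
  simp_rw [lintegral_dirac' _ hm]
  refine (tsum_subtype {j : ℕ | (j : ℕ∞) < B.N u ω}
    fun j => ENNReal.ofReal (Real.exp (-t * B.X u j ω))).trans ?_
  refine tsum_congr fun j => ?_
  simp [Set.indicator_apply]

theorem m_ne_zero (hsuper : B.Supercritical) : B.m θ ≠ 0 := by
  intro h
  have hm : Measurable fun ω => ∫⁻ x, ENNReal.ofReal (Real.exp (-θ * x)) ∂(B.offspring [] ω) := by
    simp_rw [lintegral_offspring]
    refine Measurable.tsum fun j => Measurable.ite
      (B.measurable_N [] (MeasurableSet.of_discrete (s := Set.Ioi (j : ℕ∞)))) ?_ measurable_const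
    have := B.measurable_X [] j
    fun_prop
  have h0 := (lintegral_eq_zero_iff hm).1 h
  have hN : (fun ω => (B.N [] ω : ℝ≥0∞)) =ᵐ[P] 0 := by
    filter_upwards [h0] with ω hω
    rw [lintegral_offspring] at hω
    have h1 := ENNReal.tsum_eq_zero.1 hω 0
    by_contra hcon
    have h2 : ((0 : ℕ) : ℕ∞) < B.N [] ω := by
      rw [Nat.cast_zero, pos_iff_ne_zero]
      intro h3
      exact hcon (by simp [h3])
    rw [if_pos h2, ENNReal.ofReal_eq_zero] at h1
    exact absurd h1 (not_le.2 (Real.exp_pos _))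
  unfold Supercritical at hsuper
  rw [lintegral_congr_ae hN] at hsuper
  simp at hsuper

theorem moment_eq {p : ℝ} (hp : 0 < p) : B.moment θ p = B.m (p * θ) / B.m θ ^ p := by
  unfold moment m
  simp_rw [lintegral_offspring]
  rw [lintegral_tsum, div_eq_mul_inv, ← ENNReal.tsum_mul_right]
  · refine tsum_congr fun j => ?_
    have hmeas : Measurable fun ω => if (j : ℕ∞) < B.N [] ω then
        ENNReal.ofReal (Real.exp (-(p * θ) * B.X [] j ω)) else 0 := by
      refine Measurable.ite (B.measurable_N [] (MeasurableSet.of_discrete (s := Set.Ioi (j : ℕ∞)))) ?_ measurable_const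
      have := B.measurable_X [] j
      fun_prop
    rw [← lintegral_mul_const _ hmeas]
    refine lintegral_congr fun ω => ?_
    simp only [childWeight, data, m, lintegral_offspring]
    split_ifs with h
    · rw [ENNReal.div_rpow_of_nonneg _ _ hp.le, ENNReal.ofReal_rpow_of_pos (Real.exp_pos _),
        ← Real.exp_mul, div_eq_mul_inv, show -θ * B.X [] j ω * p = -(p * θ) * B.X [] j ω by ring]
    · simp [hp]
  · intro j
    refine Measurable.aemeasurable (Measurable.ite (B.measurable_N [] (MeasurableSet.of_discrete (s := Set.Ioi (j : ℕ∞)))) ?_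
      measurable_const)
    have := B.measurable_X [] j
    fun_prop

theorem moment_one (h0 : B.m θ ≠ 0) (htop : B.m θ ≠ ∞) : B.moment θ 1 = 1 := by
  rw [moment_eq B θ one_pos, one_mul, ENNReal.rpow_one, ENNReal.div_self h0 htop]

theorem moment_eq_kappa {α : ℝ} (hα : 0 < α) : B.moment θ α = B.kappa α θ := moment_eq B θ hα

open Classical in
/-- The recursive definition of the weight agrees with the positions of the individuals born. -/
theorem lineWeight_eq (h0 : B.m θ ≠ 0) (htop : B.m θ ≠ ∞) (u : List ℕ) (ω : Ω) :
    B.lineWeight θ u ω = if B.Born u ω then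
      ENNReal.ofReal (Real.exp (-θ * B.position u ω)) / B.m θ ^ u.length else 0 := by
  induction u with
  | nil => simp [lineWeight, Born, position]
  | cons j u ih =>
    simp only [lineWeight, ih, childWeight, data, Born, position, List.length_cons]
    by_cases h1 : B.Born u ω <;> by_cases h2 : (j : ℕ∞) < B.N u ω <;> simp only [h1, h2, if_true,
      if_false, and_true, and_false, mul_zero, zero_mul]
    rw [mul_add, Real.exp_add, ENNReal.ofReal_mul (Real.exp_pos _).le, pow_succ, div_eq_mul_inv,
      div_eq_mul_inv, div_eq_mul_inv, ENNReal.mul_inv (Or.inr htop) (Or.inr h0)]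
    ring

theorem W_eq_toReal_mass (h0 : B.m θ ≠ 0) (htop : B.m θ ≠ ∞) (n : ℕ) (ω : Ω) :
    B.W θ n ω = (B.mass θ n ω).toReal := by
  classical
  have hm : Measurable fun x : ℝ => ENNReal.ofReal (Real.exp (-θ * x)) := by fun_prop
  unfold W mass
  congr 1
  rw [generation, lintegral_sum_measure]
  simp_rw [lintegral_dirac' _ hm]
  rw [show ∑' u : {u : List ℕ // u.length = n ∧ B.Born u ω},
      ENNReal.ofReal (Real.exp (-θ * B.position u ω)) = _ from
      tsum_subtype {u : List ℕ | u.length = n ∧ B.Born u ω}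
        fun u => ENNReal.ofReal (Real.exp (-θ * B.position u ω)), div_eq_mul_inv,
    ← ENNReal.tsum_mul_right]
  refine tsum_congr fun u => ?_
  rw [lineWeight_eq B θ h0 htop]
  by_cases h1 : u.length = n <;> by_cases h2 : B.Born u ω <;>
    simp [h1, h2, div_eq_mul_inv]

theorem childWeight_ne_top (h0 : B.m θ ≠ 0) (j : ℕ) (d : ℕ∞ × (ℕ → ℝ)) :
    B.childWeight θ j d ≠ ∞ := by
  unfold childWeight
  split_ifs
  · exact ENNReal.div_ne_top ENNReal.ofReal_ne_top h0
  · simp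

theorem lineWeight_ne_top (h0 : B.m θ ≠ 0) (u : List ℕ) (ω : Ω) : B.lineWeight θ u ω ≠ ∞ := by
  induction u with
  | nil => simp [lineWeight]
  | cons j u ih => exact ENNReal.mul_ne_top ih (B.childWeight_ne_top θ h0 j _)

theorem mass_zero (ω : Ω) : B.mass θ 0 ω = 1 := by
  rw [mass, tsum_length_zero fun u => B.lineWeight θ u ω]; rfl

theorem mass_succ (n : ℕ) (ω : Ω) : B.mass θ (n + 1) ω =
    ∑' u : List ℕ, if u.length = n then B.lineWeight θ u ω * B.childMass θ (B.data u ω) else 0 := by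
  rw [mass, tsum_length_succ fun u => B.lineWeight θ u ω]
  refine tsum_congr fun u => ?_
  simp only [lineWeight, ENNReal.tsum_mul_left, childMass]

theorem mass_one (ω : Ω) : B.mass θ 1 ω = B.childMass θ (B.data [] ω) := by
  rw [mass_succ, tsum_length_zero fun u => B.lineWeight θ u ω * B.childMass θ (B.data u ω)]
  simp [lineWeight]

/-! ### Independence along the tree -/

/-- The `σ`-algebra generated by the reproduction data of the individuals in `T`. -/
abbrev dataSigma (T : Set (List ℕ)) : MeasurableSpace Ω :=
  ⨆ w ∈ T, MeasurableSpace.comap (B.data w) inferInstance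

theorem measurable_data_dataSigma {T : Set (List ℕ)} {u : List ℕ} (hu : u ∈ T) :
    Measurable[B.dataSigma T] (B.data u) := by
  rw [measurable_iff_comap_le]
  exact le_iSup₂_of_le (f := fun w (_ : w ∈ T) => MeasurableSpace.comap (B.data w) inferInstance)
    u hu le_rfl

theorem measurable_lineWeight_dataSigma {T : Set (List ℕ)} (u : List ℕ)
    (hu : ∀ w : List ℕ, w.length < u.length → w ∈ T) :
    Measurable[B.dataSigma T] (B.lineWeight θ u) := by
  induction u with
  | nil => exact measurable_const
  | cons j u ih =>
    have h1 := ih fun w hw => hu w (hw.trans (by simp))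
    have h2 : Measurable[B.dataSigma T] fun ω => B.childWeight θ j (B.data u ω) :=
      (B.measurable_childWeight θ j).comp (B.measurable_data_dataSigma (hu u (by simp)))
    exact h1.mul h2

theorem measurable_fluct_dataSigma {T : Set (List ℕ)} {u : List ℕ} (hu : u ∈ T) :
    Measurable[B.dataSigma T] (B.fluct θ u) :=
  (Measurable.ennreal_toReal ((B.measurable_childMass θ).comp
    (B.measurable_data_dataSigma hu))).sub_const 1

theorem indepFun_data {E E' : Type*} [MeasurableSpace E] [MeasurableSpace E'] {T : Set (List ℕ)}
    {v : List ℕ} (hv : v ∉ T) {Z : Ω → E} (hZ : Measurable[B.dataSigma T] Z)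
    {g : ℕ∞ × (ℕ → ℝ) → E'} (hg : Measurable g) : IndepFun Z (fun ω => g (B.data v ω)) P := by
  have h1 : iIndep (fun w => MeasurableSpace.comap (B.data w) inferInstance) P :=
    (iIndepFun_iff_iIndep _ _ _).1 B.indep
  have h2 := indep_iSup_of_disjoint (fun w => (B.measurable_data w).comap_le) h1
    (Set.disjoint_singleton_right.2 hv)
  rw [IndepFun_iff_Indep]
  refine indep_of_indep_of_le_left (indep_of_indep_of_le_right h2 ?_) hZ.comap_le
  have : Measurable[⨆ w ∈ ({v} : Set (List ℕ)), MeasurableSpace.comap (B.data w) inferInstance]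
      fun ω => g (B.data v ω) :=
    hg.comp (B.measurable_data_dataSigma (T := {v}) rfl)
  exact this.comap_le

theorem identDistrib_data {E : Type*} [MeasurableSpace E] {g : ℕ∞ × (ℕ → ℝ) → E}
    (hg : Measurable g) (u : List ℕ) :
    IdentDistrib (fun ω => g (B.data u ω)) (fun ω => g (B.data [] ω)) P P :=
  (B.identDistrib u).comp hg

/-- The data of `u` are independent of the weight of `u`, which depends on its ancestors only. -/
theorem indepFun_lineWeight_data {E : Type*} [MeasurableSpace E] (u : List ℕ)
    {g : ℕ∞ × (ℕ → ℝ) → E} (hg : Measurable g) :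
    IndepFun (B.lineWeight θ u) (fun ω => g (B.data u ω)) P :=
  B.indepFun_data (T := {w | w.length < u.length}) (lt_irrefl u.length)
    (B.measurable_lineWeight_dataSigma θ u fun _ hw => hw) hg

/-- Moments of weights are multiplicative along the tree, as parent and offspring are independent. -/
theorem lintegral_lineWeight_cons (p : ℝ) (hp : 0 ≤ p) (j : ℕ) (u : List ℕ) :
    ∫⁻ ω, B.lineWeight θ (j :: u) ω ^ p ∂P =
      (∫⁻ ω, B.lineWeight θ u ω ^ p ∂P) * ∫⁻ ω, B.childWeight θ j (B.data [] ω) ^ p ∂P := by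
  have hg : Measurable fun d => B.childWeight θ j d ^ p :=
    (B.measurable_childWeight θ j).pow_const p
  have h := (B.indepFun_lineWeight_data θ u hg).comp
    (measurable_id.pow_const p : Measurable fun x : ℝ≥0∞ => x ^ p) measurable_id
  rw [← (B.identDistrib_data hg u).lintegral_eq]
  refine Eq.trans ?_ (lintegral_mul_eq_lintegral_mul_lintegral_of_indepFun
      ((B.measurable_lineWeight θ u).pow_const p) (hg.comp (B.measurable_data u)) h)
  refine lintegral_congr fun ω => ?_
  simp only [lineWeight, ENNReal.mul_rpow_of_nonneg _ _ hp, Pi.mul_apply]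

theorem tsum_lintegral_lineWeight [IsProbabilityMeasure P] {p : ℝ} (hp : 0 ≤ p) (n : ℕ) :
    ∑' u : List ℕ, (if u.length = n then ∫⁻ ω, B.lineWeight θ u ω ^ p ∂P else 0) =
      B.moment θ p ^ n := by
  induction n with
  | zero =>
    rw [tsum_length_zero fun u => ∫⁻ ω, B.lineWeight θ u ω ^ p ∂P]
    simp [lineWeight]
  | succ n ih =>
    rw [tsum_length_succ fun u => ∫⁻ ω, B.lineWeight θ u ω ^ p ∂P, pow_succ, ← ih,
      ← ENNReal.tsum_mul_right]
    refine tsum_congr fun u => ?_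
    split_ifs
    · simp_rw [B.lintegral_lineWeight_cons θ p hp, ENNReal.tsum_mul_left]
      rfl
    · simp

theorem lintegral_mass [IsProbabilityMeasure P] (h0 : B.m θ ≠ 0) (htop : B.m θ ≠ ∞) (n : ℕ) :
    ∫⁻ ω, B.mass θ n ω ∂P = 1 := by
  have h := B.tsum_lintegral_lineWeight θ zero_le_one n
  rw [B.moment_one θ h0 htop, one_pow] at h
  rw [← h]
  unfold mass
  rw [lintegral_tsum]
  · refine tsum_congr fun u => ?_
    split_ifs <;> simp
  · intro u
    split_ifs
    · exact (B.measurable_lineWeight θ u).aemeasurable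
    · exact aemeasurable_const

theorem lintegral_childMass [IsProbabilityMeasure P] (h0 : B.m θ ≠ 0) (htop : B.m θ ≠ ∞)
    (u : List ℕ) : ∫⁻ ω, B.childMass θ (B.data u ω) ∂P = 1 := by
  rw [(B.identDistrib_data (B.measurable_childMass θ) u).lintegral_eq,
    ← B.lintegral_mass θ h0 htop 1]
  exact lintegral_congr fun ω => (B.mass_one θ ω).symm

/-- The martingale increments are sums of independent fluctuations weighted by line weights. -/
theorem ae_hasSum_increment [IsProbabilityMeasure P] (h0 : B.m θ ≠ 0) (htop : B.m θ ≠ ∞) :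
    ∀ᵐ ω ∂P, ∀ n, HasSum (fun u : List ℕ => if u.length = n then
      (B.lineWeight θ u ω).toReal * B.fluct θ u ω else 0) (B.W θ (n + 1) ω - B.W θ n ω) := by
  have h1 : ∀ᵐ ω ∂P, ∀ n, B.mass θ n ω ≠ ∞ := ae_all_iff.2 fun n =>
    (ae_lt_top (B.measurable_mass θ n) (by simp [B.lintegral_mass θ h0 htop n])).mono
      fun ω h => h.ne
  filter_upwards [h1] with ω h n
  have h2 := h (n + 1)
  rw [mass_succ] at h2
  have e1 := ENNReal.hasSum_toReal (h n)
  have e2 := ENNReal.hasSum_toReal h2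
  rw [← ENNReal.tsum_toReal_eq (ENNReal.ne_top_of_tsum_ne_top (h n))] at e1
  rw [← ENNReal.tsum_toReal_eq (ENNReal.ne_top_of_tsum_ne_top h2), ← mass_succ] at e2
  rw [B.W_eq_toReal_mass θ h0 htop, B.W_eq_toReal_mass θ h0 htop]
  refine HasSum.congr_fun (e2.sub e1) fun u => ?_
  split_ifs
  · simp only [fluct, ENNReal.toReal_mul]; ring
  · simp

end BranchingRandomWalk

theorem rpow_convexComb_le {x : ℝ≥0∞} (hx : x ≠ ∞) {p q t : ℝ} (hp : 0 < p) (hq : 0 < q)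
    (ht0 : 0 ≤ t) (ht1 : t ≤ 1) :
    x ^ ((1 - t) * p + t * q) ≤ ENNReal.ofReal (1 - t) * x ^ p + ENNReal.ofReal t * x ^ q := by
  lift x to NNReal using hx
  have hpq : 0 < (1 - t) * p + t * q := by
    rcases ht0.eq_or_lt with h | h
    · rw [← h]; linarith
    · have := mul_nonneg (sub_nonneg.2 ht1) hp.le
      have := mul_pos h hq
      linarith
  have h := Real.geom_mean_le_arith_mean2_weighted (sub_nonneg.2 ht1) ht0
    (Real.rpow_nonneg x.coe_nonneg p) (Real.rpow_nonneg x.coe_nonneg q) (by ring)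
  rw [← Real.rpow_mul x.coe_nonneg, ← Real.rpow_mul x.coe_nonneg, ← Real.rpow_add' x.coe_nonneg (by
    rw [mul_comm p, mul_comm q]; exact hpq.ne')] at h
  rw [← ENNReal.ofReal_coe_nnreal, ENNReal.ofReal_rpow_of_nonneg x.coe_nonneg hpq.le,
    ENNReal.ofReal_rpow_of_nonneg x.coe_nonneg hp.le, ENNReal.ofReal_rpow_of_nonneg x.coe_nonneg hq.le,
    ← ENNReal.ofReal_mul (by linarith), ← ENNReal.ofReal_mul ht0, ← ENNReal.ofReal_add
      (mul_nonneg (sub_nonneg.2 ht1) (Real.rpow_nonneg x.coe_nonneg p))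
      (mul_nonneg ht0 (Real.rpow_nonneg x.coe_nonneg q))]
  refine ENNReal.ofReal_le_ofReal ?_
  rwa [mul_comm p, mul_comm q] at h

namespace BranchingRandomWalk

variable {Ω : Type*} [MeasurableSpace Ω] {P : Measure Ω} (B : BranchingRandomWalk P) (θ : ℝ)

/-- Convexity of the normalized moment in the exponent. -/
theorem moment_convexComb_le (h0 : B.m θ ≠ 0) {p q t : ℝ} (hp : 0 < p) (hq : 0 < q)
    (ht0 : 0 ≤ t) (ht1 : t ≤ 1) : B.moment θ ((1 - t) * p + t * q) ≤
      ENNReal.ofReal (1 - t) * B.moment θ p + ENNReal.ofReal t * B.moment θ q := by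
  unfold moment
  have hm : ∀ j (r : ℝ), Measurable fun ω => B.childWeight θ j (B.data [] ω) ^ r := fun j r =>
    ((B.measurable_childWeight θ j).comp (B.measurable_data [])).pow_const r
  rw [← ENNReal.tsum_mul_left, ← ENNReal.tsum_mul_left, ← ENNReal.tsum_add]
  refine ENNReal.tsum_le_tsum fun j => ?_
  rw [← lintegral_const_mul _ (hm j p), ← lintegral_const_mul _ (hm j q),
    ← lintegral_add_left ((hm j p).const_mul _)]
  exact lintegral_mono fun ω => rpow_convexComb_le (B.childWeight_ne_top θ h0 j _)
    hp hq ht0 ht1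

/-- Since `k(1) = 1` and `k(α) < 1`, the normalized moment is less than one on `(1, α]`. -/
theorem moment_lt_one (h0 : B.m θ ≠ 0) (htop : B.m θ ≠ ∞) {α p : ℝ}
    (hκ : B.moment θ α < 1) (hp1 : 1 < p) (hpα : p ≤ α) : B.moment θ p < 1 := by
  have hα : 0 < α - 1 := by linarith
  set t := (p - 1) / (α - 1) with ht
  have ht0 : 0 < t := div_pos (by linarith) hα
  have ht1 : t ≤ 1 := (div_le_one hα).2 (by linarith)
  have e : (1 - t) * 1 + t * α = p := by
    have : t * (α - 1) = p - 1 := div_mul_cancel₀ _ hα.ne'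
    linarith
  have h := B.moment_convexComb_le θ h0 one_pos (show 0 < α by linarith) ht0.le ht1
  rw [e, B.moment_one θ h0 htop, mul_one] at h
  refine h.trans_lt ?_
  have h1 : ENNReal.ofReal (1 - t) + ENNReal.ofReal t = 1 := by
    rw [← ENNReal.ofReal_add (by linarith) ht0.le]; simp
  rw [← h1]
  refine ENNReal.add_lt_add_left ENNReal.ofReal_ne_top ?_
  nth_rw 2 [← mul_one (ENNReal.ofReal t)]
  exact (ENNReal.mul_lt_mul_iff_right (by simpa using ht0) ENNReal.ofReal_ne_top).2 hκ

/-- If some moment beyond `α` is finite, then the normalized moment is still less than one slightly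
beyond `α`. -/
theorem exists_moment_lt_one (h0 : B.m θ ≠ 0) {α ε : ℝ} (hα : 1 < α) (hα2 : α < 2)
    (hκ : B.moment θ α < 1) (hε : 0 < ε) (hm : B.moment θ (α + ε) ≠ ∞) :
    ∃ γ, α < γ ∧ γ < 2 ∧ B.moment θ γ < 1 := by
  have hlim : Tendsto (fun t : ℝ => ENNReal.ofReal (1 - t) * B.moment θ α +
      ENNReal.ofReal t * B.moment θ (α + ε)) (𝓝 0) (𝓝 (ENNReal.ofReal (1 - 0) * B.moment θ α +
      ENNReal.ofReal 0 * B.moment θ (α + ε))) := by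
    refine Tendsto.add ?_ ?_
    · refine ENNReal.Tendsto.mul_const ?_ (Or.inr (hκ.trans ENNReal.one_lt_top).ne)
      exact (ENNReal.continuous_ofReal.comp (by fun_prop : Continuous fun t : ℝ => 1 - t)).tendsto 0
    · exact ENNReal.Tendsto.mul_const (ENNReal.continuous_ofReal.tendsto 0) (Or.inr hm)
  simp only [sub_zero, ENNReal.ofReal_one, one_mul, ENNReal.ofReal_zero, zero_mul, add_zero] at hlim
  have hlim2 : Tendsto (fun t : ℝ => (1 - t) * α + t * (α + ε)) (𝓝 0) (𝓝 α) := by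
    have : Continuous fun t : ℝ => (1 - t) * α + t * (α + ε) := by fun_prop
    simpa using this.tendsto 0
  have hev := ((hlim.mono_left (nhdsWithin_le_nhds (s := Set.Ioi 0))).eventually
    (gt_mem_nhds hκ)).and (((hlim2.mono_left (nhdsWithin_le_nhds (s := Set.Ioi 0))).eventually
    (gt_mem_nhds hα2)).and (Ioo_mem_nhdsGT zero_lt_one))
  obtain ⟨t, h1, h2, h3, h4⟩ := hev.exists
  refine ⟨(1 - t) * α + t * (α + ε), ?_, h2, ?_⟩
  · nlinarith
  · exact (B.moment_convexComb_le θ h0 (by linarith) (by linarith) h3.le h4.le).trans_lt h1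

/-! ### Weighted sums of fluctuations over words -/

/-- The fluctuation at the individual `u`, weighted by its line weight and by a real number. -/
noncomputable def term (w : List ℕ → ℝ) (u : List ℕ) (ω : Ω) : ℝ :=
  w u * (B.lineWeight θ u ω).toReal * B.fluct θ u ω

variable (w : List ℕ → ℝ)

theorem measurable_term (u : List ℕ) : Measurable (B.term θ w u) :=
  ((B.measurable_lineWeight θ u).ennreal_toReal.const_mul _).mul (B.measurable_fluct θ u)

theorem measurable_sum_term (s : Finset (List ℕ)) :
    Measurable fun ω => ∑ u ∈ s, B.term θ w u ω :=
  Finset.measurable_sum _ fun u _ => B.measurable_term θ w u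

/-- In an order of nondecreasing generations, each new fluctuation is independent of the preceding
terms and of its own line weight. -/
theorem indepFun_sum_fluct {s : Finset (List ℕ)} {v : List ℕ} (hv : v ∉ s)
    (hs : ∀ u ∈ s, u.length ≤ v.length) :
    IndepFun (fun ω => (∑ u ∈ s, B.term θ w u ω, w v * (B.lineWeight θ v ω).toReal))
      (B.fluct θ v) P := by
  have hL : ∀ u : List ℕ, u.length ≤ v.length →
      Measurable[B.dataSigma {v}ᶜ] (B.lineWeight θ u) := fun u hu =>
    B.measurable_lineWeight_dataSigma θ u fun x hx hxv => by
      rw [Set.mem_singleton_iff] at hxv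
      rw [hxv] at hx
      omega
  have hg : Measurable fun d => (B.childMass θ d).toReal - 1 :=
    (B.measurable_childMass θ).ennreal_toReal.sub_const 1
  refine B.indepFun_data (T := {v}ᶜ) (v := v) (by simp) ?_ hg
  refine Measurable.prodMk ?_ ((hL v le_rfl).ennreal_toReal.const_mul _)
  refine Finset.measurable_sum _ fun u hu => ?_
  refine ((hL u (hs u hu)).ennreal_toReal.const_mul _).mul (B.measurable_fluct_dataSigma θ ?_)
  intro h
  rw [Set.mem_singleton_iff] at h
  exact hv (h ▸ hu)

theorem identDistrib_fluct (u : List ℕ) : IdentDistrib (B.fluct θ u) (B.fluct θ []) P P :=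
  B.identDistrib_data (g := fun d => (B.childMass θ d).toReal - 1)
    ((B.measurable_childMass θ).ennreal_toReal.sub_const 1) u

theorem indepFun_coeff_fluct (u : List ℕ) :
    IndepFun (fun ω => w u * (B.lineWeight θ u ω).toReal) (B.fluct θ u) P :=
  (B.indepFun_sum_fluct θ w (s := ∅) (v := u) (by simp) (by simp)).comp measurable_snd measurable_id

variable [IsProbabilityMeasure P]

theorem integrable_fluct (h0 : B.m θ ≠ 0) (htop : B.m θ ≠ ∞) (u : List ℕ) :
    Integrable (B.fluct θ u) P := by
  refine Integrable.sub (integrable_toReal_of_lintegral_ne_top ?_ ?_) (integrable_const 1)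
  · exact ((B.measurable_childMass θ).comp (B.measurable_data u)).aemeasurable
  · rw [B.lintegral_childMass θ h0 htop]; simp

theorem integral_fluct (h0 : B.m θ ≠ 0) (htop : B.m θ ≠ ∞) (u : List ℕ) :
    ∫ ω, B.fluct θ u ω ∂P = 0 := by
  have hm : AEMeasurable (fun ω => B.childMass θ (B.data u ω)) P :=
    ((B.measurable_childMass θ).comp (B.measurable_data u)).aemeasurable
  have h1 := B.lintegral_childMass θ h0 htop u
  have h2 : ∫⁻ ω, B.childMass θ (B.data u ω) ∂P ≠ ∞ := by rw [h1]; simp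
  unfold fluct
  rw [integral_sub (integrable_toReal_of_lintegral_ne_top hm h2) (integrable_const 1),
    integral_toReal hm (ae_lt_top' hm h2), h1]
  simp

theorem lintegral_lineWeight_le_one (h0 : B.m θ ≠ 0) (htop : B.m θ ≠ ∞) (u : List ℕ) :
    ∫⁻ ω, B.lineWeight θ u ω ∂P ≤ 1 := by
  rw [← B.lintegral_mass θ h0 htop u.length]
  refine lintegral_mono fun ω => ?_
  refine le_trans (by simp) (ENNReal.le_tsum u)

theorem integrable_lineWeight (h0 : B.m θ ≠ 0) (htop : B.m θ ≠ ∞) (u : List ℕ) :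
    Integrable (fun ω => (B.lineWeight θ u ω).toReal) P :=
  integrable_toReal_of_lintegral_ne_top (B.measurable_lineWeight θ u).aemeasurable
    ((B.lintegral_lineWeight_le_one θ h0 htop u).trans_lt ENNReal.one_lt_top).ne

theorem integrable_term (h0 : B.m θ ≠ 0) (htop : B.m θ ≠ ∞) (u : List ℕ) :
    Integrable (B.term θ w u) P :=
  (B.indepFun_coeff_fluct θ w u).integrable_mul ((B.integrable_lineWeight θ h0 htop u).const_mul _)
    (B.integrable_fluct θ h0 htop u)

/-- A von Bahr–Esseen type inequality: if the Taylor remainder of `φ` is bounded by `χ`, then the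
`φ`-moment of a sum of weighted fluctuations is at most the sum of the `χ`-moments of the terms.
The linear Taylor terms have mean zero by independence. -/
theorem integral_sum_term_le (h0 : B.m θ ≠ 0) (htop : B.m θ ≠ ∞) {φ ψ χ : ℝ → ℝ} (hφ0 : φ 0 = 0)
    (hψ : Measurable ψ) (hadd : ∀ a b, φ (a + b) ≤ φ a + ψ a * b + χ b)
    (hφi : ∀ s : Finset (List ℕ), Integrable (fun ω => φ (∑ u ∈ s, B.term θ w u ω)) P)
    (hχi : ∀ u, Integrable (fun ω => χ (B.term θ w u ω)) P)
    (hψi : ∀ (s : Finset (List ℕ)) (v : List ℕ),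
      Integrable (fun ω => ψ (∑ u ∈ s, B.term θ w u ω) * B.term θ w v ω) P)
    (s : Finset (List ℕ)) :
    ∫ ω, φ (∑ u ∈ s, B.term θ w u ω) ∂P ≤ ∑ u ∈ s, ∫ ω, χ (B.term θ w u ω) ∂P := by
  refine Finset.induction_on_max_value List.length s ?_ fun v s hv hs ih => ?_
  · simp [hφ0]
  · rw [Finset.sum_insert hv]
    have hzero : ∫ ω, ψ (∑ u ∈ s, B.term θ w u ω) * B.term θ w v ω ∂P = 0 := by
      have hg : Measurable fun q : ℝ × ℝ => ψ q.1 * q.2 :=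
        (hψ.comp measurable_fst).mul measurable_snd
      have hi := (B.indepFun_sum_fluct θ w hv hs).comp hg measurable_id
      have hZ : Measurable fun ω => (∑ u ∈ s, B.term θ w u ω, w v * (B.lineWeight θ v ω).toReal) :=
        (B.measurable_sum_term θ w s).prodMk
          ((B.measurable_lineWeight θ v).ennreal_toReal.const_mul _)
      have := hi.integral_fun_mul_eq_mul_integral (hg.comp hZ).aestronglyMeasurable
        (B.measurable_fluct θ v).aestronglyMeasurable
      simp only [Function.comp, id, B.integral_fluct θ h0 htop v, mul_zero] at this
      rw [← this]
      refine integral_congr_ae (Eventually.of_forall fun ω => ?_)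
      simp only [term]; ring
    have hi2 : Integrable (fun ω => φ (∑ u ∈ s, B.term θ w u ω) +
        ψ (∑ u ∈ s, B.term θ w u ω) * B.term θ w v ω) P := (hφi s).add (hψi s v)
    calc ∫ ω, φ (∑ u ∈ insert v s, B.term θ w u ω) ∂P
        ≤ ∫ ω, (φ (∑ u ∈ s, B.term θ w u ω) + ψ (∑ u ∈ s, B.term θ w u ω) * B.term θ w v ω
            + χ (B.term θ w v ω)) ∂P := by
          refine integral_mono (hφi _) (hi2.add (hχi v)) fun ω => ?_
          simp only [Finset.sum_insert hv, add_comm (B.term θ w v ω)]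
          exact hadd _ _
      _ = ∫ ω, φ (∑ u ∈ s, B.term θ w u ω) ∂P + ∫ ω, χ (B.term θ w v ω) ∂P := by
          rw [integral_add hi2 (hχi v), integral_add (hφi s) (hψi s v), hzero,
            add_zero]
      _ ≤ _ := by linarith

/-- The inequality `integral_sum_term_le` for infinite sums, by Fatou's lemma. -/
theorem lintegral_hasSum_term_le (h0 : B.m θ ≠ 0) (htop : B.m θ ≠ ∞) {φ ψ χ : ℝ → ℝ}
    (hφ0 : φ 0 = 0) (hφnn : ∀ x, 0 ≤ φ x) (hχnn : ∀ x, 0 ≤ χ x) (hφc : Continuous φ)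
    (hψ : Measurable ψ) (hadd : ∀ a b, φ (a + b) ≤ φ a + ψ a * b + χ b)
    (hφi : ∀ s : Finset (List ℕ), Integrable (fun ω => φ (∑ u ∈ s, B.term θ w u ω)) P)
    (hχi : ∀ u, Integrable (fun ω => χ (B.term θ w u ω)) P)
    (hψi : ∀ (s : Finset (List ℕ)) (v : List ℕ),
      Integrable (fun ω => ψ (∑ u ∈ s, B.term θ w u ω) * B.term θ w v ω) P)
    {Z : Ω → ℝ} (hZ : ∀ᵐ ω ∂P, HasSum (fun u => B.term θ w u ω) (Z ω)) :
    ∫⁻ ω, ENNReal.ofReal (φ (Z ω)) ∂P ≤ ∑' u, ∫⁻ ω, ENNReal.ofReal (χ (B.term θ w u ω)) ∂P := by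
  obtain ⟨s, hs⟩ := exists_seq_tendsto (atTop : Filter (Finset (List ℕ)))
  have hfin : ∀ n, ∫⁻ ω, ENNReal.ofReal (φ (∑ u ∈ s n, B.term θ w u ω)) ∂P ≤
      ∑' u, ∫⁻ ω, ENNReal.ofReal (χ (B.term θ w u ω)) ∂P := fun n => by
    rw [← ofReal_integral_eq_lintegral_ofReal (hφi _) (Eventually.of_forall fun ω => hφnn _)]
    refine (ENNReal.ofReal_le_ofReal (B.integral_sum_term_le θ w h0 htop hφ0 hψ hadd hφi hχi
      hψi (s n))).trans ?_
    rw [ENNReal.ofReal_sum_of_nonneg fun u _ => integral_nonneg fun ω => hχnn _]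
    refine le_trans (Finset.sum_le_sum fun u _ => ?_) (ENNReal.sum_le_tsum (s n))
    rw [ofReal_integral_eq_lintegral_ofReal (hχi _) (Eventually.of_forall fun ω => hχnn _)]
  calc ∫⁻ ω, ENNReal.ofReal (φ (Z ω)) ∂P
      = ∫⁻ ω, liminf (fun n => ENNReal.ofReal (φ (∑ u ∈ s n, B.term θ w u ω))) atTop ∂P := by
        refine lintegral_congr_ae ?_
        filter_upwards [hZ] with ω hω
        have h1 : Tendsto (fun n => ∑ u ∈ s n, B.term θ w u ω) atTop (𝓝 (Z ω)) := hω.comp hs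
        exact (((ENNReal.continuous_ofReal.comp hφc).tendsto _).comp h1).liminf_eq.symm
    _ ≤ liminf (fun n => ∫⁻ ω, ENNReal.ofReal (φ (∑ u ∈ s n, B.term θ w u ω)) ∂P) atTop :=
        lintegral_liminf_le fun n =>
          (hφc.measurable.comp (B.measurable_sum_term θ w (s n))).ennreal_ofReal
    _ ≤ _ := by
        refine liminf_le_of_le (by isBoundedDefault) fun b hb => ?_
        obtain ⟨n, hn⟩ := hb.exists
        exact hn.trans (hfin n)

/-- The case `φ(x) = √(1 + x²) - 1`, which is used for tails. -/
theorem lintegral_pseudoHuber_le (h0 : B.m θ ≠ 0) (htop : B.m θ ≠ ∞) {Z : Ω → ℝ}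
    (hZ : ∀ᵐ ω ∂P, HasSum (fun u => B.term θ w u ω) (Z ω)) :
    ∫⁻ ω, ENNReal.ofReal (pseudoHuber (Z ω)) ∂P ≤
      ∑' u, ∫⁻ ω, ENNReal.ofReal (quadLin (B.term θ w u ω)) ∂P := by
  have hi := B.integrable_term θ w h0 htop
  refine B.lintegral_hasSum_term_le θ w h0 htop pseudoHuber_zero pseudoHuber_nonneg quadLin_nonneg
    continuous_pseudoHuber measurable_pseudoHuberDeriv pseudoHuber_add_le (fun s => ?_)
    (fun u => ?_) (fun s v => ?_) hZ
  · refine (integrable_finsetSum s fun u _ => hi u).mono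
      (continuous_pseudoHuber.measurable.comp (B.measurable_sum_term θ w s)).aestronglyMeasurable
      (Eventually.of_forall fun ω => ?_)
    rw [Real.norm_eq_abs, abs_of_nonneg (pseudoHuber_nonneg _)]
    exact pseudoHuber_le_abs _
  · refine ((hi u).const_mul 2).mono
      (measurable_quadLin.comp (B.measurable_term θ w u)).aestronglyMeasurable
      (Eventually.of_forall fun ω => ?_)
    rw [Real.norm_eq_abs, abs_of_nonneg (quadLin_nonneg _), norm_mul]
    simpa using quadLin_le_abs (B.term θ w u ω)
  · refine (hi v).mono ((measurable_pseudoHuberDeriv.comp (B.measurable_sum_term θ w s)).mul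
      (B.measurable_term θ w v)).aestronglyMeasurable (Eventually.of_forall fun ω => ?_)
    rw [norm_mul]
    exact mul_le_of_le_one_left (norm_nonneg _) (abs_pseudoHuberDeriv_le _)

theorem rpow_sub_one_mul_le {a b p : ℝ} (ha : 0 ≤ a) (hb : 0 ≤ b) (hp : 1 < p) :
    a ^ (p - 1) * b ≤ a ^ p + b ^ p := by
  have hp1 : 0 ≤ p - 1 := by linarith
  have e : ∀ z : ℝ, 0 ≤ z → z ^ (p - 1) * z = z ^ p := fun z hz => by
    nth_rw 2 [← Real.rpow_one z]
    rw [← Real.rpow_add' hz (by linarith)]; congr 1; ring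
  rcases le_total a b with h | h
  · calc a ^ (p - 1) * b ≤ b ^ (p - 1) * b := by gcongr
      _ = b ^ p := e b hb
      _ ≤ _ := by linarith [Real.rpow_nonneg ha p]
  · calc a ^ (p - 1) * b ≤ a ^ (p - 1) * a := by gcongr
      _ = a ^ p := e a ha
      _ ≤ _ := by linarith [Real.rpow_nonneg hb p]

/-- The case `φ(x) = |x| ^ p`, which is used for convergence in `L_p`. -/
theorem lintegral_rpow_le (h0 : B.m θ ≠ 0) (htop : B.m θ ≠ ∞) {p : ℝ} (hp1 : 1 < p) (hp2 : p ≤ 2)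
    (hLp : ∀ u, MemLp (B.term θ w u) (ENNReal.ofReal p) P) {Z : Ω → ℝ}
    (hZ : ∀ᵐ ω ∂P, HasSum (fun u => B.term θ w u ω) (Z ω)) :
    ∫⁻ ω, ENNReal.ofReal (|Z ω| ^ p) ∂P ≤
      ∑' u, ∫⁻ ω, ENNReal.ofReal (4 * |B.term θ w u ω| ^ p) ∂P := by
  have hp0 : 0 < p := by linarith
  have hint : ∀ f : Ω → ℝ, MemLp f (ENNReal.ofReal p) P → Integrable (fun ω => |f ω| ^ p) P := by
    intro f hf
    have := hf.integrable_norm_rpow (by simpa using hp0) ENNReal.ofReal_ne_top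
    simpa [ENNReal.toReal_ofReal hp0.le] using this
  have hs : ∀ s : Finset (List ℕ), Integrable (fun ω => |∑ u ∈ s, B.term θ w u ω| ^ p) P :=
    fun s => hint _ (memLp_finsetSum s fun u _ => hLp u)
  refine B.lintegral_hasSum_term_le θ w h0 htop (φ := fun x => |x| ^ p)
    (ψ := fun x => p * |x| ^ (p - 2) * x) (χ := fun x => 4 * |x| ^ p)
    (by simp [hp0.ne']) (fun x => by positivity) (fun x => by positivity)
    (continuous_abs.rpow_const fun _ => Or.inr hp0.le) (by fun_prop)
    (abs_add_rpow_le hp1 hp2) hs (fun u => (hint _ (hLp u)).const_mul 4) (fun s v => ?_) hZ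
  refine (((hs s).add (hint _ (hLp v))).const_mul p).mono ?_ (Eventually.of_forall fun ω => ?_)
  · have h1 := B.measurable_sum_term θ w s
    have h2 := B.measurable_term θ w v
    exact Measurable.aestronglyMeasurable (by fun_prop)
  · set a := ∑ u ∈ s, B.term θ w u ω
    set b := B.term θ w v ω
    have e : |a| ^ (p - 2) * |a| = |a| ^ (p - 1) := by
      rcases (abs_nonneg a).eq_or_lt with h | h
      · rw [← h]; simp [Real.zero_rpow (show p - 1 ≠ 0 by linarith)]
      · nth_rw 2 [← Real.rpow_one |a|]
        rw [← Real.rpow_add h]; congr 1; ring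
    have h3 := rpow_sub_one_mul_le (abs_nonneg a) (abs_nonneg b) hp1
    simp only [Pi.add_apply, Real.norm_eq_abs, abs_mul, abs_of_pos hp0]
    rw [abs_of_nonneg (Real.rpow_nonneg (abs_nonneg a) _), mul_assoc p, e, mul_assoc,
      abs_of_nonneg (add_nonneg (Real.rpow_nonneg (abs_nonneg a) _)
        (Real.rpow_nonneg (abs_nonneg b) _))]
    exact mul_le_mul_of_nonneg_left h3 hp0.le

end BranchingRandomWalk

theorem lintegral_comp_eq_of_indepFun {Ω : Type*} [MeasurableSpace Ω] {P : Measure Ω}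
    [IsProbabilityMeasure P] {E E' : Type*} [MeasurableSpace E] [MeasurableSpace E'] {Z : Ω → E}
    {Y : Ω → E'} (hZ : Measurable Z) (hY : Measurable Y) (h : IndepFun Z Y P) {f : E × E' → ℝ≥0∞}
    (hf : Measurable f) :
    ∫⁻ ω, f (Z ω, Y ω) ∂P = ∫⁻ ω, ∫⁻ ω', f (Z ω, Y ω') ∂P ∂P := by
  have hprod := (indepFun_iff_map_prod_eq_prod_map_map hZ.aemeasurable hY.aemeasurable).1 h
  have := Measure.isProbabilityMeasure_map (μ := P) hY.aemeasurable
  rw [← lintegral_map hf (hZ.prodMk hY), hprod, lintegral_prod _ hf.aemeasurable,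
    lintegral_map hf.lintegral_prod_right' hZ]
  refine lintegral_congr fun ω => ?_
  exact lintegral_map (hf.comp measurable_prodMk_left) hY

theorem eLpNorm_real_eq {Ω : Type*} [MeasurableSpace Ω] {P : Measure Ω} (f : Ω → ℝ) {p : ℝ}
    (hp : 0 < p) : eLpNorm f (ENNReal.ofReal p) P =
      (∫⁻ ω, ENNReal.ofReal (|f ω| ^ p) ∂P) ^ (1 / p) := by
  rw [eLpNorm_eq_lintegral_rpow_enorm_toReal (by simpa using hp) ENNReal.ofReal_ne_top,
    ENNReal.toReal_ofReal hp.le]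
  congr 1
  refine lintegral_congr fun ω => ?_
  rw [Real.enorm_eq_ofReal_abs, ENNReal.ofReal_rpow_of_nonneg (abs_nonneg _) hp.le]

namespace BranchingRandomWalk

variable {Ω : Type*} [MeasurableSpace Ω] {P : Measure Ω} (B : BranchingRandomWalk P) (θ : ℝ)

theorem measurable_W (h0 : B.m θ ≠ 0) (htop : B.m θ ≠ ∞) (n : ℕ) : Measurable (B.W θ n) := by
  rw [show B.W θ n = fun ω => (B.mass θ n ω).toReal from
    funext fun ω => B.W_eq_toReal_mass θ h0 htop n ω]
  exact (B.measurable_mass θ n).ennreal_toReal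

theorem measurable_partialSum (h0 : B.m θ ≠ 0) (htop : B.m θ ≠ ∞) (a : ℕ → ℝ) (n : ℕ) :
    Measurable (B.partialSum θ a n) :=
  Finset.measurable_sum _ fun j _ =>
    ((B.measurable_W θ h0 htop (j + 1)).sub (B.measurable_W θ h0 htop j)).const_mul _

theorem W_zero (h0 : B.m θ ≠ 0) (htop : B.m θ ≠ ∞) (ω : Ω) : B.W θ 0 ω = 1 := by
  rw [B.W_eq_toReal_mass θ h0 htop, mass_zero, ENNReal.toReal_one]

theorem W_nonneg (n : ℕ) (ω : Ω) : 0 ≤ B.W θ n ω := ENNReal.toReal_nonneg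

theorem fluct_nil (h0 : B.m θ ≠ 0) (htop : B.m θ ≠ ∞) (ω : Ω) :
    B.fluct θ [] ω = B.W θ 1 ω - 1 := by
  rw [B.W_eq_toReal_mass θ h0 htop, mass_one, fluct]

/-! ### Convergence of the series -/

theorem eLpNorm_partialSum_sub_le (h0 : B.m θ ≠ 0) (htop : B.m θ ≠ ∞) {a : ℕ → ℝ} {C : ℝ}
    (ha : ∀ j, |a j| ≤ C) {q : ℝ} (hq : 1 ≤ q) (n k : ℕ) :
    eLpNorm (B.partialSum θ a (n + k) - B.partialSum θ a n) (ENNReal.ofReal q) P ≤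
      ENNReal.ofReal C * ∑' j, eLpNorm (fun ω => B.W θ (j + n + 1) ω - B.W θ (j + n) ω)
        (ENNReal.ofReal q) P := by
  have hm : ∀ j, Measurable fun ω => B.W θ (j + 1) ω - B.W θ j ω := fun j =>
    (B.measurable_W θ h0 htop (j + 1)).sub (B.measurable_W θ h0 htop j)
  have e : B.partialSum θ a (n + k) - B.partialSum θ a n =
      ∑ j ∈ Finset.range k, a (n + j) • fun ω => B.W θ (j + n + 1) ω - B.W θ (j + n) ω := by
    ext ω
    simp only [Pi.sub_apply, partialSum, Finset.sum_apply, Pi.smul_apply, smul_eq_mul]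
    rw [Finset.sum_range_add_sub_sum_range]
    refine Finset.sum_congr rfl fun j _ => ?_
    rw [add_comm n j]
  rw [e]
  refine (eLpNorm_sum_le (fun j _ => ((hm (j + n)).aestronglyMeasurable.const_smul _))
    (by simpa using hq)).trans ?_
  rw [← ENNReal.tsum_mul_left]
  refine le_trans (Finset.sum_le_sum fun j _ => ?_) (ENNReal.sum_le_tsum (Finset.range k))
  refine eLpNorm_const_smul_le.trans ?_
  gcongr
  rw [Real.enorm_eq_ofReal_abs]
  exact ENNReal.ofReal_le_ofReal (ha _)

theorem ae_tendsto_partialSum (h0 : B.m θ ≠ 0) (htop : B.m θ ≠ ∞) {a : ℕ → ℝ} {C : ℝ}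
    (ha : ∀ j, |a j| ≤ C) (hsum : ∑' n, eLpNorm (fun ω => B.W θ (n + 1) ω - B.W θ n ω)
      (ENNReal.ofReal 1) P < ∞) :
    ∀ᵐ ω ∂P, Tendsto (fun n => B.partialSum θ a n ω) atTop
      (𝓝 (∑' j, a j * (B.W θ (j + 1) ω - B.W θ j ω))) := by
  have hm : ∀ j, Measurable fun ω => B.W θ (j + 1) ω - B.W θ j ω := fun j =>
    (B.measurable_W θ h0 htop (j + 1)).sub (B.measurable_W θ h0 htop j)
  simp only [ENNReal.ofReal_one, eLpNorm_one_eq_lintegral_enorm] at hsum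
  rw [← lintegral_tsum fun j => (hm j).enorm.aemeasurable] at hsum
  filter_upwards [ae_lt_top (Measurable.tsum fun j => (hm j).enorm) hsum.ne] with ω hω
  refine HasSum.tendsto_sum_nat (Summable.hasSum ?_)
  have h1 : Summable fun j => ‖B.W θ (j + 1) ω - B.W θ j ω‖ := by
    simpa using ENNReal.summable_toReal hω.ne
  refine Summable.of_norm_bounded (h1.mul_left C) fun j => ?_
  rw [norm_mul]
  exact mul_le_mul_of_nonneg_right (ha j) (norm_nonneg _)

theorem memLp_and_tendsto_eLpNorm (h0 : B.m θ ≠ 0) (htop : B.m θ ≠ ∞) {a : ℕ → ℝ} {C : ℝ}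
    (ha : ∀ j, |a j| ≤ C) {q : ℝ} (hq : 1 ≤ q)
    (hsum : ∑' n, eLpNorm (fun ω => B.W θ (n + 1) ω - B.W θ n ω) (ENNReal.ofReal q) P < ∞)
    {R : Ω → ℝ} (hRm : Measurable R)
    (hR : ∀ᵐ ω ∂P, Tendsto (fun n => B.partialSum θ a n ω) atTop (𝓝 (R ω))) :
    MemLp R (ENNReal.ofReal q) P ∧ (∀ n, MemLp (B.partialSum θ a n) (ENNReal.ofReal q) P) ∧
      Tendsto (fun n => eLpNorm (B.partialSum θ a n - R) (ENNReal.ofReal q) P) atTop (𝓝 0) := by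
  have hSm := B.measurable_partialSum θ h0 htop a
  set T : ℕ → ℝ≥0∞ := fun n => ∑' j, eLpNorm (fun ω => B.W θ (j + n + 1) ω - B.W θ (j + n) ω)
    (ENNReal.ofReal q) P with hT
  have hbound : ∀ n, eLpNorm (B.partialSum θ a n - R) (ENNReal.ofReal q) P ≤
      ENNReal.ofReal C * T n := by
    intro n
    rw [eLpNorm_sub_comm]
    refine (Lp.eLpNorm_lim_le_liminf_eLpNorm
      (f := fun k => B.partialSum θ a (n + k) - B.partialSum θ a n)
      (fun k => ((hSm (n + k)).sub (hSm n)).aestronglyMeasurable) _ ?_).trans ?_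
    · filter_upwards [hR] with ω hω
      have : Tendsto (fun k => n + k) atTop atTop :=
        tendsto_atTop_mono (fun k => Nat.le_add_left k n) tendsto_id
      exact (hω.comp this).sub_const _
    · refine liminf_le_of_le (by isBoundedDefault) fun b hb => ?_
      obtain ⟨k, hk⟩ := hb.exists
      exact hk.trans (B.eLpNorm_partialSum_sub_le θ h0 htop ha hq n k)
  have hTtop : ∀ n, T n < ∞ := fun n =>
    (ENNReal.tsum_comp_le_tsum_of_injective (add_left_injective n) _).trans_lt hsum
  have hdiff : ∀ n, MemLp (B.partialSum θ a n - R) (ENNReal.ofReal q) P := fun n =>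
    ⟨((hSm n).sub hRm).aestronglyMeasurable, (hbound n).trans_lt
      (ENNReal.mul_lt_top ENNReal.ofReal_lt_top (hTtop n))⟩
  have hRL : MemLp R (ENNReal.ofReal q) P := by
    have h := (hdiff 0).neg
    have e : -(B.partialSum θ a 0 - R) = R := by
      ext ω; simp [partialSum]
    rwa [e] at h
  refine ⟨hRL, fun n => ?_, ?_⟩
  · have h := (hdiff n).add hRL
    rwa [sub_add_cancel] at h
  · refine tendsto_of_tendsto_of_tendsto_of_le_of_le tendsto_const_nhds ?_ (fun _ => zero_le)
      hbound
    have h := ENNReal.Tendsto.const_mul (a := ENNReal.ofReal C)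
      (ENNReal.tendsto_sum_nat_add _ hsum.ne) (Or.inr ENNReal.ofReal_ne_top)
    rw [mul_zero] at h
    exact h

/-! ### Moments of the weighted terms -/

theorem lintegral_coeff_rpow_le {w : List ℕ → ℝ} {C p : ℝ} (hp : 0 ≤ p) (h0 : B.m θ ≠ 0)
    {u : List ℕ} (hw : |w u| ≤ C) :
    ∫⁻ ω, ENNReal.ofReal (|w u * (B.lineWeight θ u ω).toReal| ^ p) ∂P ≤
      ENNReal.ofReal (C ^ p) * ∫⁻ ω, B.lineWeight θ u ω ^ p ∂P := by
  rw [← lintegral_const_mul _ ((B.measurable_lineWeight θ u).pow_const p)]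
  refine lintegral_mono fun ω => ?_
  rw [abs_mul, Real.mul_rpow (abs_nonneg _) (abs_nonneg _), abs_of_nonneg ENNReal.toReal_nonneg,
    ENNReal.ofReal_mul (Real.rpow_nonneg (abs_nonneg _) _),
    ← ENNReal.ofReal_rpow_of_nonneg ENNReal.toReal_nonneg hp,
    ENNReal.ofReal_toReal (B.lineWeight_ne_top θ h0 u ω)]
  gcongr

theorem lintegral_term_rpow (w : List ℕ → ℝ) (u : List ℕ) (p : ℝ) :
    ∫⁻ ω, ENNReal.ofReal (|B.term θ w u ω| ^ p) ∂P =
      (∫⁻ ω, ENNReal.ofReal (|w u * (B.lineWeight θ u ω).toReal| ^ p) ∂P) *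
        ∫⁻ ω, ENNReal.ofReal (|B.fluct θ [] ω| ^ p) ∂P := by
  have hc : Measurable fun ω => w u * (B.lineWeight θ u ω).toReal :=
    (B.measurable_lineWeight θ u).ennreal_toReal.const_mul _
  have hm : Measurable fun x : ℝ => ENNReal.ofReal (|x| ^ p) := by fun_prop
  have h1 := ((B.identDistrib_fluct θ u).comp hm).lintegral_eq
  simp only [Function.comp] at h1
  rw [← h1]
  refine Eq.trans ?_ (lintegral_mul_eq_lintegral_mul_lintegral_of_indepFun (hm.comp hc)
    (hm.comp (B.measurable_fluct θ u)) ((B.indepFun_coeff_fluct θ w u).comp hm hm))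
  refine lintegral_congr fun ω => ?_
  simp only [Pi.mul_apply, term]
  rw [abs_mul, Real.mul_rpow (abs_nonneg _) (abs_nonneg _),
    ENNReal.ofReal_mul (Real.rpow_nonneg (abs_nonneg _) _)]

variable [IsProbabilityMeasure P]

theorem tsum_lintegral_lineWeight_lt_top {p : ℝ} (hp : 0 ≤ p) (hm : B.moment θ p < 1) :
    ∑' u : List ℕ, ∫⁻ ω, B.lineWeight θ u ω ^ p ∂P < ∞ := by
  rw [tsum_eq_tsum_tsum_length]
  simp_rw [B.tsum_lintegral_lineWeight θ hp]
  rw [ENNReal.tsum_geometric]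
  simpa using hm

theorem tsum_lintegral_coeff_rpow_lt_top {w : List ℕ → ℝ} {C p : ℝ} (hp : 0 ≤ p)
    (h0 : B.m θ ≠ 0) (hw : ∀ u, |w u| ≤ C) (hm : B.moment θ p < 1) :
    ∑' u : List ℕ, ∫⁻ ω, ENNReal.ofReal (|w u * (B.lineWeight θ u ω).toReal| ^ p) ∂P < ∞ := by
  refine (ENNReal.tsum_le_tsum fun u => B.lintegral_coeff_rpow_le θ hp h0 (hw u)).trans_lt ?_
  rw [ENNReal.tsum_mul_left]
  exact ENNReal.mul_lt_top ENNReal.ofReal_lt_top (B.tsum_lintegral_lineWeight_lt_top θ hp hm)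

theorem lintegral_fluct_rpow_lt_top (h0 : B.m θ ≠ 0) (htop : B.m θ ≠ ∞) {p : ℝ} (hp : 1 ≤ p)
    (hV : ∫⁻ ω, ENNReal.ofReal (B.W θ 1 ω ^ p) ∂P < ∞) :
    ∫⁻ ω, ENNReal.ofReal (|B.fluct θ [] ω| ^ p) ∂P < ∞ := by
  have hle : ∀ ω, ENNReal.ofReal (|B.fluct θ [] ω| ^ p) ≤ ENNReal.ofReal (B.W θ 1 ω ^ p) + 1 := by
    intro ω
    rw [B.fluct_nil θ h0 htop, ← ENNReal.ofReal_one,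
      ← ENNReal.ofReal_add (Real.rpow_nonneg (B.W_nonneg θ 1 ω) p) zero_le_one]
    refine ENNReal.ofReal_le_ofReal ?_
    have hw := B.W_nonneg θ 1 ω
    have hwp := Real.rpow_nonneg hw p
    rcases le_total 1 (B.W θ 1 ω) with h | h
    · rw [abs_of_nonneg (by linarith)]
      have := Real.rpow_le_rpow (z := p) (by linarith : 0 ≤ B.W θ 1 ω - 1)
        (by linarith : B.W θ 1 ω - 1 ≤ B.W θ 1 ω) (by linarith)
      linarith
    · have : |B.W θ 1 ω - 1| ^ p ≤ 1 := Real.rpow_le_one (abs_nonneg _)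
        (by rw [abs_le]; constructor <;> linarith) (by linarith)
      linarith
  refine (lintegral_mono hle).trans_lt ?_
  rw [lintegral_add_right _ measurable_const]
  exact ENNReal.add_lt_top.2 ⟨hV, by simp⟩

theorem memLp_term (h0 : B.m θ ≠ 0) {w : List ℕ → ℝ} {p : ℝ} (hp : 1 ≤ p)
    (hm : B.moment θ p < 1) (hY : ∫⁻ ω, ENNReal.ofReal (|B.fluct θ [] ω| ^ p) ∂P < ∞)
    (u : List ℕ) : MemLp (B.term θ w u) (ENNReal.ofReal p) P := by
  refine ⟨(B.measurable_term θ w u).aestronglyMeasurable, ?_⟩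
  rw [eLpNorm_real_eq _ (by linarith), B.lintegral_term_rpow]
  refine ENNReal.rpow_lt_top_of_nonneg (by positivity) (ENNReal.mul_lt_top ?_ hY).ne
  refine (B.lintegral_coeff_rpow_le θ (by linarith) h0 le_rfl).trans_lt ?_
  exact ENNReal.mul_lt_top ENNReal.ofReal_lt_top ((ENNReal.le_tsum u).trans_lt
    (B.tsum_lintegral_lineWeight_lt_top θ (by linarith) hm))

/-- The increments of the martingale decay geometrically in `L_p`. -/
theorem eLpNorm_increment_le (h0 : B.m θ ≠ 0) (htop : B.m θ ≠ ∞) {p : ℝ} (hp1 : 1 < p)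
    (hp2 : p ≤ 2) (hm : B.moment θ p < 1)
    (hY : ∫⁻ ω, ENNReal.ofReal (|B.fluct θ [] ω| ^ p) ∂P < ∞) (n : ℕ) :
    eLpNorm (fun ω => B.W θ (n + 1) ω - B.W θ n ω) (ENNReal.ofReal p) P ≤
      (4 * ∫⁻ ω, ENNReal.ofReal (|B.fluct θ [] ω| ^ p) ∂P) ^ (1 / p) *
        (B.moment θ p ^ (1 / p)) ^ n := by
  have hp0 : 0 < p := by linarith
  set w : List ℕ → ℝ := fun u => if u.length = n then 1 else 0 with hw
  have hZ : ∀ᵐ ω ∂P, HasSum (fun u => B.term θ w u ω) (B.W θ (n + 1) ω - B.W θ n ω) := by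
    filter_upwards [B.ae_hasSum_increment θ h0 htop] with ω hω
    refine (hω n).congr_fun fun u => ?_
    simp only [term, hw]
    split_ifs <;> simp
  have h1 := B.lintegral_rpow_le θ w h0 htop hp1 hp2
    (fun u => B.memLp_term θ h0 hp1.le hm hY u) hZ
  rw [eLpNorm_real_eq _ hp0]
  set E := ∫⁻ ω, ENNReal.ofReal (|B.fluct θ [] ω| ^ p) ∂P with hE
  have h2 : ∑' u, ∫⁻ ω, ENNReal.ofReal (4 * |B.term θ w u ω| ^ p) ∂P ≤
      4 * E * B.moment θ p ^ n := by
    rw [← B.tsum_lintegral_lineWeight θ hp0.le n, ← ENNReal.tsum_mul_left]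
    refine ENNReal.tsum_le_tsum fun u => ?_
    have e1 : ∫⁻ ω, ENNReal.ofReal (4 * |B.term θ w u ω| ^ p) ∂P =
        4 * ∫⁻ ω, ENNReal.ofReal (|B.term θ w u ω| ^ p) ∂P := by
      rw [← lintegral_const_mul' _ _ (by simp)]
      refine lintegral_congr fun ω => ?_
      rw [ENNReal.ofReal_mul (by norm_num)]; simp
    rw [e1, B.lintegral_term_rpow, ← hE, mul_assoc 4, mul_comm E]
    gcongr
    split_ifs with h
    · have := B.lintegral_coeff_rpow_le θ (C := 1) (w := w) (u := u) hp0.le h0 (by simp [hw, h])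
      simpa using this
    · simp [hw, h, hp0.ne']
  calc _ ≤ (4 * E * B.moment θ p ^ n) ^ (1 / p) :=
        ENNReal.rpow_le_rpow (h1.trans h2) (by positivity)
    _ = _ := by
        rw [ENNReal.mul_rpow_of_nonneg _ _ (by positivity), ← ENNReal.rpow_natCast,
          ← ENNReal.rpow_mul, mul_comm (n : ℝ), ENNReal.rpow_mul, ENNReal.rpow_natCast]

/-- The geometric decay in `L_p` makes the `L_q` norms summable for every `q ≤ p`, including `q = 1`,
where no decay is available directly as `k(1) = 1`. -/
theorem tsum_eLpNorm_increment_lt_top (h0 : B.m θ ≠ 0) (htop : B.m θ ≠ ∞) {p q : ℝ} (hp1 : 1 < p)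
    (hp2 : p ≤ 2) (hqp : q ≤ p) (hm : B.moment θ p < 1)
    (hY : ∫⁻ ω, ENNReal.ofReal (|B.fluct θ [] ω| ^ p) ∂P < ∞) :
    ∑' n, eLpNorm (fun ω => B.W θ (n + 1) ω - B.W θ n ω) (ENNReal.ofReal q) P < ∞ := by
  have hp0 : 0 < p := by linarith
  refine (ENNReal.tsum_le_tsum fun n => (eLpNorm_le_eLpNorm_of_exponent_le
    (ENNReal.ofReal_le_ofReal hqp) ((B.measurable_W θ h0 htop (n + 1)).sub
      (B.measurable_W θ h0 htop n)).aestronglyMeasurable).trans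
      (B.eLpNorm_increment_le θ h0 htop hp1 hp2 hm hY n)).trans_lt ?_
  rw [ENNReal.tsum_mul_left, ENNReal.tsum_geometric]
  refine ENNReal.mul_lt_top (ENNReal.rpow_lt_top_of_nonneg (by positivity)
    (ENNReal.mul_lt_top (by simp) hY).ne) ?_
  have : B.moment θ p ^ (1 / p) < 1 := ENNReal.rpow_lt_one hm (by positivity)
  simpa using this

end BranchingRandomWalk

namespace BranchingRandomWalk

variable {Ω : Type*} [MeasurableSpace Ω] {P : Measure Ω} (B : BranchingRandomWalk P) (θ : ℝ)

/-! ### Tail bounds for infinite weighted sums -/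

/-- The sum of the moments of orders `β` and `γ` of the coefficient of the fluctuation at `u`. It
controls the contribution of `u` to the tail of a weighted sum. -/
noncomputable def coeffMoment (β γ : ℝ) (w : List ℕ → ℝ) (u : List ℕ) : ℝ≥0∞ :=
  ∫⁻ ω, ENNReal.ofReal (|w u * (B.lineWeight θ u ω).toReal| ^ β +
    |w u * (B.lineWeight θ u ω).toReal| ^ γ) ∂P

/-- The restriction of the weights `a_{|u|}` to the words outside a finite set. -/
def weightOutside (a : ℕ → ℝ) (s : Finset (List ℕ)) (u : List ℕ) : ℝ :=
  if u ∈ s then 0 else a u.length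

/-- The partial sum of the series without the words in `s`, divided by `x`, as a weighted sum over all
words. -/
theorem hasSum_term_partialSum_sub {a : ℕ → ℝ} {ω : Ω}
    (hω : ∀ n, HasSum (fun u : List ℕ => if u.length = n then
      (B.lineWeight θ u ω).toReal * B.fluct θ u ω else 0) (B.W θ (n + 1) ω - B.W θ n ω))
    (s : Finset (List ℕ)) (n : ℕ) (x : ℝ) :
    HasSum (fun u => B.term θ (fun u => if u.length < n then weightOutside a s u / x else 0) u ω)
      ((B.partialSum θ a n ω -
        ∑ u ∈ s, if u.length < n then B.term θ (fun u => a u.length) u ω else 0) / x) := by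
  have h1 : HasSum (fun u : List ℕ => ∑ j ∈ Finset.range n, a j * (if u.length = j then
      (B.lineWeight θ u ω).toReal * B.fluct θ u ω else 0)) (B.partialSum θ a n ω) :=
    hasSum_sum fun j _ => (hω j).mul_left (a j)
  have h2 : HasSum (fun u : List ℕ => if u ∈ s then
      (if u.length < n then B.term θ (fun u => a u.length) u ω else 0) else 0)
      (∑ u ∈ s, if u.length < n then B.term θ (fun u => a u.length) u ω else 0) := by
    have h3 : ∑ u ∈ s, (if u.length < n then B.term θ (fun u => a u.length) u ω else 0) =
        ∑ u ∈ s, if u ∈ s then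
          (if u.length < n then B.term θ (fun u => a u.length) u ω else 0) else 0 :=
      Finset.sum_congr rfl fun u hu => by rw [if_pos hu]
    rw [h3]
    exact hasSum_sum_of_ne_finset_zero fun u hu => if_neg hu
  refine ((h1.sub h2).div_const x).congr_fun fun u => ?_
  have e : ∑ j ∈ Finset.range n, a j * (if u.length = j then
      (B.lineWeight θ u ω).toReal * B.fluct θ u ω else 0) =
      if u.length < n then B.term θ (fun u => a u.length) u ω else 0 := by
    simp only [mul_ite, mul_zero, Finset.sum_ite_eq, Finset.mem_range, term, mul_assoc]
  rw [e]
  simp only [weightOutside, term]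
  split_ifs
  · simp
  · rw [sub_zero]; ring
  all_goals simp

/-- The total moment of the coefficients outside a finite set of words is small for large sets. -/
theorem tendsto_tsum_coeffMoment_weightOutside {a : ℕ → ℝ} {β γ : ℝ} (hβ : 0 < β) (hγ : 0 < γ)
    (h : ∑' u, B.coeffMoment θ β γ (fun u => a u.length) u ≠ ∞) :
    Tendsto (fun s : Finset (List ℕ) => ∑' u, B.coeffMoment θ β γ (weightOutside a s) u) atTop
      (𝓝 0) := by
  refine (ENNReal.tendsto_tsum_compl_atTop_zero h).congr fun s => ?_
  refine (tsum_subtype {u | u ∉ s} fun u => B.coeffMoment θ β γ (fun u => a u.length) u).trans ?_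
  refine tsum_congr fun u => ?_
  by_cases hu : u ∈ s
  · simp [hu, coeffMoment, weightOutside, hβ.ne', hγ.ne']
  · simp [hu, coeffMoment, weightOutside]

/-- A bound `K (|r| ^ β + |r| ^ γ) F(x)` on the quadratic-linear moments of the multiples
`r (W_1 - 1) / x` of the fluctuation, where `F` is the tail of `W_1`. -/
def FluctBound (β γ K x₀ : ℝ) : Prop :=
  ∀ x, x₀ ≤ x → ∀ r, ∫⁻ ω, ENNReal.ofReal (quadLin (r * B.fluct θ [] ω / x)) ∂P ≤
    ENNReal.ofReal (K * (|r| ^ β + |r| ^ γ) * P.real {ω | B.W θ 1 ω > x})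

section

variable {B θ}

theorem FluctBound.lintegral_le {β γ K x₀ : ℝ} (hb : B.FluctBound θ β γ K x₀) {x : ℝ}
    (hx : x₀ ≤ x) (r : ℝ) (u : List ℕ) :
    ∫⁻ ω, ENNReal.ofReal (quadLin (r * B.fluct θ u ω / x)) ∂P ≤
      ENNReal.ofReal (K * (|r| ^ β + |r| ^ γ) * P.real {ω | B.W θ 1 ω > x}) := by
  have hm : Measurable fun y : ℝ => ENNReal.ofReal (quadLin (r * y / x)) :=
    (measurable_quadLin.comp (by fun_prop)).ennreal_ofReal
  exact (((B.identDistrib_fluct θ u).comp hm).lintegral_eq).trans_le (hb x hx r)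

theorem FluctBound.measureReal_abs_mul_le {β γ K x₀ : ℝ} (hb : B.FluctBound θ β γ K x₀)
    (hK : 0 ≤ K) {x : ℝ} (hx : x₀ ≤ x) (hx0 : 0 < x) (r : ℝ) (u : List ℕ) :
    P.real {ω | x ≤ |r * B.fluct θ u ω|} ≤
      K * (|r| ^ β + |r| ^ γ) * P.real {ω | B.W θ 1 ω > x} := by
  have hm : Measurable fun ω => ENNReal.ofReal (quadLin (r * B.fluct θ u ω / x)) :=
    (measurable_quadLin.comp (((B.measurable_fluct θ u).const_mul r).div_const x)).ennreal_ofReal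
  have h1 := mul_meas_ge_le_lintegral hm 1 (μ := P)
  rw [one_mul] at h1
  have h2 : P {ω | x ≤ |r * B.fluct θ u ω|} ≤
      ENNReal.ofReal (K * (|r| ^ β + |r| ^ γ) * P.real {ω | B.W θ 1 ω > x}) := by
    refine (measure_mono fun ω (hω : x ≤ |r * B.fluct θ u ω|) => ?_).trans
      (h1.trans (hb.lintegral_le hx r u))
    show 1 ≤ ENNReal.ofReal (quadLin (r * B.fluct θ u ω / x))
    rw [← ENNReal.ofReal_one]
    refine ENNReal.ofReal_le_ofReal (one_le_quadLin ?_)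
    rwa [abs_div, abs_of_pos hx0, one_le_div hx0]
  refine ENNReal.toReal_le_of_le_ofReal ?_ h2
  exact mul_nonneg (mul_nonneg hK (add_nonneg (Real.rpow_nonneg (abs_nonneg _) _)
    (Real.rpow_nonneg (abs_nonneg _) _))) measureReal_nonneg

end

variable [IsProbabilityMeasure P]

/-- The bound on the pseudo-Huber moment of the remainder of the limit `R` after removal of finitely
many terms. -/
theorem lintegral_pseudoHuber_remainder_le (h0 : B.m θ ≠ 0) (htop : B.m θ ≠ ∞) {a : ℕ → ℝ}
    {R : Ω → ℝ} (hR : ∀ᵐ ω ∂P, Tendsto (fun n => B.partialSum θ a n ω) atTop (𝓝 (R ω)))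
    (s : Finset (List ℕ)) (x : ℝ) :
    ∫⁻ ω, ENNReal.ofReal (pseudoHuber
      ((R ω - ∑ u ∈ s, B.term θ (fun u => a u.length) u ω) / x)) ∂P ≤
      ∑' u, ∫⁻ ω, ENNReal.ofReal (quadLin (B.term θ (weightOutside a s) u ω / x)) ∂P := by
  set Z : ℕ → Ω → ℝ := fun n ω => (B.partialSum θ a n ω -
    ∑ u ∈ s, if u.length < n then B.term θ (fun u => a u.length) u ω else 0) / x with hZ
  have hfin : ∀ n, ∫⁻ ω, ENNReal.ofReal (pseudoHuber (Z n ω)) ∂P ≤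
      ∑' u, ∫⁻ ω, ENNReal.ofReal (quadLin (B.term θ (weightOutside a s) u ω / x)) ∂P := by
    intro n
    refine (B.lintegral_pseudoHuber_le θ
      (fun u => if u.length < n then weightOutside a s u / x else 0) h0 htop ?_).trans
      (ENNReal.tsum_le_tsum fun u => lintegral_mono fun ω => ENNReal.ofReal_le_ofReal
        (quadLin_mono ?_))
    · filter_upwards [B.ae_hasSum_increment θ h0 htop] with ω hω
      exact B.hasSum_term_partialSum_sub θ hω s n x
    · simp only [term]
      split_ifs
      · exact le_of_eq (by congr 1; ring)
      · simp
  have hZm : ∀ n, Measurable (Z n) := fun n => by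
    refine ((B.measurable_partialSum θ h0 htop a n).sub
      (Finset.measurable_sum _ fun u _ => ?_)).div_const x
    split_ifs
    · exact B.measurable_term θ _ u
    · exact measurable_const
  calc _ = ∫⁻ ω, liminf (fun n => ENNReal.ofReal (pseudoHuber (Z n ω))) atTop ∂P := by
        refine lintegral_congr_ae ?_
        filter_upwards [hR] with ω hω
        have h1 : Tendsto (fun n => ∑ u ∈ s, if u.length < n then
            B.term θ (fun u => a u.length) u ω else 0) atTop
            (𝓝 (∑ u ∈ s, B.term θ (fun u => a u.length) u ω)) := by
          refine tendsto_finsetSum _ fun u _ => tendsto_const_nhds.congr' ?_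
          filter_upwards [eventually_gt_atTop u.length] with n hn
          rw [if_pos hn]
        exact (((ENNReal.continuous_ofReal.comp continuous_pseudoHuber).tendsto _).comp
          ((hω.sub h1).div_const x)).liminf_eq.symm
    _ ≤ liminf (fun n => ∫⁻ ω, ENNReal.ofReal (pseudoHuber (Z n ω)) ∂P) atTop :=
        lintegral_liminf_le fun n => (continuous_pseudoHuber.measurable.comp (hZm n)).ennreal_ofReal
    _ ≤ _ := by
        refine liminf_le_of_le (by isBoundedDefault) fun b hb => ?_
        obtain ⟨n, hn⟩ := hb.exists
        exact hn.trans (hfin n)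

variable {B θ}

theorem FluctBound.lintegral_term_le {β γ K x₀ : ℝ} (hb : B.FluctBound θ β γ K x₀) (hK : 0 ≤ K)
    {x : ℝ} (hx : x₀ ≤ x) (w : List ℕ → ℝ) (u : List ℕ) :
    ∫⁻ ω, ENNReal.ofReal (quadLin (B.term θ w u ω / x)) ∂P ≤
      ENNReal.ofReal (K * P.real {ω | B.W θ 1 ω > x}) * B.coeffMoment θ β γ w u := by
  have hc : Measurable fun ω => w u * (B.lineWeight θ u ω).toReal :=
    (B.measurable_lineWeight θ u).ennreal_toReal.const_mul _
  have hf : Measurable fun q : ℝ × ℝ => ENNReal.ofReal (quadLin (q.1 * q.2 / x)) :=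
    (measurable_quadLin.comp (by fun_prop)).ennreal_ofReal
  unfold term coeffMoment
  rw [lintegral_comp_eq_of_indepFun hc (B.measurable_fluct θ u) (B.indepFun_coeff_fluct θ w u) hf,
    ← lintegral_const_mul' _ _ ENNReal.ofReal_ne_top]
  refine lintegral_mono fun ω => (hb.lintegral_le hx _ u).trans ?_
  rw [← ENNReal.ofReal_mul (by positivity)]
  exact ENNReal.ofReal_le_ofReal (mul_right_comm _ _ _).le

theorem FluctBound.measureReal_remainder_le {β γ K x₀ : ℝ} (hb : B.FluctBound θ β γ K x₀)
    (hK : 0 ≤ K) (h0 : B.m θ ≠ 0) (htop : B.m θ ≠ ∞) {a : ℕ → ℝ}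
    {R : Ω → ℝ} (hRm : Measurable R)
    (hR : ∀ᵐ ω ∂P, Tendsto (fun n => B.partialSum θ a n ω) atTop (𝓝 (R ω)))
    (s : Finset (List ℕ)) (hs : ∑' u, B.coeffMoment θ β γ (weightOutside a s) u ≠ ∞)
    {x : ℝ} (hx : x₀ ≤ x) (hx0 : 0 < x) :
    P.real {ω | x ≤ |R ω - ∑ u ∈ s, B.term θ (fun u => a u.length) u ω|} ≤
      3 * K * (∑' u, B.coeffMoment θ β γ (weightOutside a s) u).toReal *
        P.real {ω | B.W θ 1 ω > x} := by
  set M : Ω → ℝ := fun ω => ∑ u ∈ s, B.term θ (fun u => a u.length) u ω with hM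
  set F := P.real {ω | B.W θ 1 ω > x}
  set S := ∑' u, B.coeffMoment θ β γ (weightOutside a s) u with hS
  have hm : Measurable fun ω => ENNReal.ofReal (pseudoHuber ((R ω - M ω) / x)) :=
    (continuous_pseudoHuber.measurable.comp
      ((hRm.sub (B.measurable_sum_term θ _ s)).div_const x)).ennreal_ofReal
  have h1 : ∫⁻ ω, ENNReal.ofReal (pseudoHuber ((R ω - M ω) / x)) ∂P ≤
      ENNReal.ofReal (K * F) * S := by
    refine (B.lintegral_pseudoHuber_remainder_le θ h0 htop hR s x).trans ?_
    rw [hS, ← ENNReal.tsum_mul_left]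
    exact ENNReal.tsum_le_tsum fun u => hb.lintegral_term_le hK hx _ u
  have h2 := mul_meas_ge_le_lintegral (hm.const_mul 3) 1 (μ := P)
  rw [one_mul, lintegral_const_mul _ hm] at h2
  have h3 : P {ω | x ≤ |R ω - M ω|} ≤ ENNReal.ofReal (3 * K * S.toReal * F) := by
    refine (measure_mono fun ω (hω : x ≤ |R ω - M ω|) => ?_).trans (h2.trans ?_)
    · show 1 ≤ 3 * ENNReal.ofReal (pseudoHuber ((R ω - M ω) / x))
      rw [show (3 : ℝ≥0∞) = ENNReal.ofReal 3 by simp, ← ENNReal.ofReal_mul (by norm_num),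
        ← ENNReal.ofReal_one]
      refine ENNReal.ofReal_le_ofReal (one_le_three_mul_pseudoHuber ?_)
      rwa [abs_div, abs_of_pos hx0, one_le_div hx0]
    · refine (mul_le_mul_of_nonneg_left h1 zero_le).trans (le_of_eq ?_)
      rw [← ENNReal.ofReal_toReal hs, show (3 : ℝ≥0∞) = ENNReal.ofReal 3 by simp,
        ENNReal.toReal_ofReal ENNReal.toReal_nonneg,
        ← ENNReal.ofReal_mul (mul_nonneg hK measureReal_nonneg),
        ← ENNReal.ofReal_mul (by norm_num)]
      congr 1; ring
  refine ENNReal.toReal_le_of_le_ofReal ?_ h3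
  exact mul_nonneg (by positivity) measureReal_nonneg

variable (B θ)

theorem tsum_coeffMoment_lt_top (h0 : B.m θ ≠ 0) {w : List ℕ → ℝ} {C β γ : ℝ}
    (hβ : 0 ≤ β) (hγ : 0 ≤ γ) (hw : ∀ u, |w u| ≤ C) (hmβ : B.moment θ β < 1)
    (hmγ : B.moment θ γ < 1) : ∑' u, B.coeffMoment θ β γ w u < ∞ := by
  have e : ∀ u, B.coeffMoment θ β γ w u =
      ∫⁻ ω, ENNReal.ofReal (|w u * (B.lineWeight θ u ω).toReal| ^ β) ∂P +
      ∫⁻ ω, ENNReal.ofReal (|w u * (B.lineWeight θ u ω).toReal| ^ γ) ∂P := fun u => by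
    have hm : Measurable fun ω => ENNReal.ofReal (|w u * (B.lineWeight θ u ω).toReal| ^ β) := by
      have := (B.measurable_lineWeight θ u).ennreal_toReal
      fun_prop
    rw [← lintegral_add_left hm]
    refine lintegral_congr fun ω => ?_
    rw [ENNReal.ofReal_add (by positivity) (by positivity)]
  simp_rw [e]
  rw [ENNReal.tsum_add]
  exact ENNReal.add_lt_top.2 ⟨B.tsum_lintegral_coeff_rpow_lt_top θ hβ h0 hw hmβ,
    B.tsum_lintegral_coeff_rpow_lt_top θ hγ h0 hw hmγ⟩

/-! ### The tail of the limit -/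

/-- The tail of a finite weighted sum, by adding the words in an order of nondecreasing length. -/
theorem tendsto_tail_sum_term (h0 : B.m θ ≠ 0) (htop : B.m θ ≠ ∞) {α β γ K x₀ : ℝ} (hα : 0 < α)
    (hF : IsRegVar (fun x => P.real {ω | B.W θ 1 ω > x}) α)
    (hpos : ∀ x, 0 < P.real {ω | B.W θ 1 ω > x}) (hb : B.FluctBound θ β γ K x₀) (hK : 0 ≤ K)
    {w : List ℕ → ℝ} (hw : ∀ u, B.coeffMoment θ β γ w u < ∞) (s : Finset (List ℕ)) :
    Tendsto (fun x => P.real {ω | ∑ u ∈ s, B.term θ w u ω > x} / P.real {ω | B.W θ 1 ω > x}) atTop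
      (𝓝 (∑ u ∈ s, ∫ ω, (max (w u * (B.lineWeight θ u ω).toReal) 0) ^ α ∂P)) := by
  refine Finset.induction_on_max_value List.length s ?_ fun v s hv hs ih => ?_
  · rw [Finset.sum_empty]
    refine tendsto_const_nhds.congr' ?_
    filter_upwards [eventually_ge_atTop 0] with x hx
    have : {ω : Ω | ∑ u ∈ (∅ : Finset (List ℕ)), B.term θ w u ω > x} = ∅ :=
      Set.eq_empty_of_forall_notMem fun ω (hω : _ > x) => by
        rw [Finset.sum_empty] at hω; linarith
    rw [this, measureReal_empty, zero_div]
  · have hm := (B.measurable_lineWeight θ v).ennreal_toReal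
    have hterm : IsBigJumpTerm P (fun x => P.real {ω | B.W θ 1 ω > x})
        (fun r => K * (|r| ^ β + |r| ^ γ)) (fun ω => ∑ u ∈ s, B.term θ w u ω)
        (fun ω => w v * (B.lineWeight θ v ω).toReal) (B.fluct θ v) :=
      { measurable_M := B.measurable_sum_term θ w s
        measurable_c := hm.const_mul _
        measurable_Y := B.measurable_fluct θ v
        indep := B.indepFun_sum_fluct θ w hv hs
        neg_one_le := B.neg_one_le_fluct θ v
        tail := fun x => by
          have h1 := (B.identDistrib_fluct θ v).measure_mem_eq
            (s := Set.Ioi (x - 1)) measurableSet_Ioi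
          simp only [measureReal_def]
          congr 1
          refine Eq.trans ?_ (h1.trans ?_)
          · congr 1; ext ω; simp [sub_lt_iff_lt_add]
          · congr 1; ext ω; simp [B.fluct_nil θ h0 htop]
        integrable := by
          refine Integrable.const_mul ?_ K
          refine ⟨Measurable.aestronglyMeasurable (by fun_prop), ?_⟩
          rw [hasFiniteIntegral_iff_ofReal (Eventually.of_forall fun ω => by positivity)]
          exact hw v
        bound := by
          filter_upwards [eventually_ge_atTop x₀, eventually_gt_atTop 0] with x hx hx0 r
          exact hb.measureReal_abs_mul_le hK hx hx0 r v }
    rw [Finset.sum_insert hv, add_comm]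
    refine (hterm.tendsto_tail_add hF hpos hα ih).congr fun x => ?_
    congr 3
    ext ω
    rw [Finset.sum_insert hv, add_comm]
    rfl

/-- The sum over all individuals of the `α`-moments of the positive parts of the coefficients. -/
theorem hasSum_integral_max_rpow (h0 : B.m θ ≠ 0) {a : ℕ → ℝ} {C α : ℝ} (ha : ∀ j, |a j| ≤ C)
    (hα : 0 < α) (hm : B.moment θ α < 1) :
    HasSum (fun u : List ℕ => ∫ ω, (max (a u.length * (B.lineWeight θ u ω).toReal) 0) ^ α ∂P)
      (∑' j, (B.moment θ α).toReal ^ j * (max (a j) 0) ^ α) := by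
  set f : List ℕ → ℝ≥0∞ := fun u =>
    ENNReal.ofReal ((max (a u.length) 0) ^ α) * ∫⁻ ω, B.lineWeight θ u ω ^ α ∂P with hf
  have hmax : ∀ j, 0 ≤ (max (a j) 0) ^ α := fun j => by positivity
  have h1 : ∀ u : List ℕ, ∫ ω, (max (a u.length * (B.lineWeight θ u ω).toReal) 0) ^ α ∂P =
      (f u).toReal := by
    intro u
    have e : ∀ ω, (max (a u.length * (B.lineWeight θ u ω).toReal) 0) ^ α =
        (max (a u.length) 0) ^ α * (B.lineWeight θ u ω ^ α).toReal := fun ω => by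
      have hL : 0 ≤ (B.lineWeight θ u ω).toReal := ENNReal.toReal_nonneg
      rw [← ENNReal.toReal_rpow, ← Real.mul_rpow (le_max_right _ _) hL, max_mul_of_nonneg _ _ hL,
        zero_mul]
    simp_rw [e]
    rw [integral_const_mul, hf, ENNReal.toReal_mul, ENNReal.toReal_ofReal (hmax _),
      integral_toReal ((B.measurable_lineWeight θ u).pow_const α).aemeasurable]
    exact Eventually.of_forall fun ω =>
      ENNReal.rpow_lt_top_of_nonneg hα.le (B.lineWeight_ne_top θ h0 u ω)
  have h2 : ∑' u, f u = ∑' j, ENNReal.ofReal ((max (a j) 0) ^ α) * B.moment θ α ^ j := by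
    rw [tsum_eq_tsum_tsum_length]
    refine tsum_congr fun j => ?_
    rw [← B.tsum_lintegral_lineWeight θ hα.le j, ← ENNReal.tsum_mul_left]
    refine tsum_congr fun u => ?_
    split_ifs with h
    · rw [hf, ← h]
    · rw [mul_zero]
  have h3 : ∑' u, f u ≠ ∞ := by
    have hle : ∑' u, f u ≤ ∑' u, ENNReal.ofReal (C ^ α) * ∫⁻ ω, B.lineWeight θ u ω ^ α ∂P := by
      refine ENNReal.tsum_le_tsum fun u => mul_le_mul_of_nonneg_right
        (ENNReal.ofReal_le_ofReal (Real.rpow_le_rpow (le_max_right _ _) ?_ hα.le)) zero_le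
      exact max_le ((le_abs_self _).trans (ha _)) ((abs_nonneg _).trans (ha 0))
    rw [ENNReal.tsum_mul_left] at hle
    exact (hle.trans_lt (ENNReal.mul_lt_top ENNReal.ofReal_lt_top
      (B.tsum_lintegral_lineWeight_lt_top θ hα.le hm))).ne
  simp_rw [h1]
  have h4 := ENNReal.hasSum_toReal h3
  have h5 : ∑' u, (f u).toReal = ∑' j, (B.moment θ α).toReal ^ j * (max (a j) 0) ^ α := by
    rw [← ENNReal.tsum_toReal_eq (ENNReal.ne_top_of_tsum_ne_top h3), h2,
      ENNReal.tsum_toReal_eq (ENNReal.ne_top_of_tsum_ne_top (h2 ▸ h3))]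
    refine tsum_congr fun j => ?_
    rw [ENNReal.toReal_mul, ENNReal.toReal_ofReal (hmax _), ENNReal.toReal_pow, mul_comm]
  rwa [h5] at h4

/-- The right tail of the limit of the series: finitely many words give the tail up to a small multiple
of the tail of `W_1`. -/
theorem tendsto_tail_limit (h0 : B.m θ ≠ 0) (htop : B.m θ ≠ ∞) {α β γ K x₀ : ℝ} (hα : 0 < α)
    (hβ : 0 < β) (hγ : 0 < γ)
    (hF : IsRegVar (fun x => P.real {ω | B.W θ 1 ω > x}) α)
    (hpos : ∀ x, 0 < P.real {ω | B.W θ 1 ω > x}) (hb : B.FluctBound θ β γ K x₀) (hK : 0 ≤ K)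
    (hmα : B.moment θ α < 1) (hmβ : B.moment θ β < 1) (hmγ : B.moment θ γ < 1)
    {a : ℕ → ℝ} {C : ℝ} (ha : ∀ j, |a j| ≤ C) {R : Ω → ℝ} (hRm : Measurable R)
    (hR : ∀ᵐ ω ∂P, Tendsto (fun n => B.partialSum θ a n ω) atTop (𝓝 (R ω))) :
    Tendsto (fun x => P.real {ω | R ω > x} / P.real {ω | B.W θ 1 ω > x}) atTop
      (𝓝 (∑' j, (B.moment θ α).toReal ^ j * (max (a j) 0) ^ α)) := by
  have hw : ∀ u : List ℕ, |a u.length| ≤ C := fun u => ha _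
  have hC : 0 ≤ C := (abs_nonneg _).trans (ha 0)
  have hout : ∀ (s : Finset (List ℕ)) u, |weightOutside a s u| ≤ C := fun s u => by
    unfold weightOutside
    split_ifs
    · simpa using hC
    · exact ha _
  have htsum := B.tsum_coeffMoment_lt_top θ h0 (w := fun u => a u.length) hβ.le hγ.le hw hmβ hmγ
  have hδ := (((ENNReal.tendsto_toReal ENNReal.zero_ne_top).comp
    (B.tendsto_tsum_coeffMoment_weightOutside θ hβ hγ htsum.ne))).const_mul (3 * K)
  rw [ENNReal.toReal_zero, mul_zero] at hδ
  refine tendsto_tail_of_approx hF hpos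
    (M := fun s ω => ∑ u ∈ s, B.term θ (fun u => a u.length) u ω)
    (fun s => B.tendsto_tail_sum_term θ h0 htop hα hF hpos hb hK
      (fun u => (ENNReal.le_tsum u).trans_lt htsum) s)
    (B.hasSum_integral_max_rpow θ h0 ha hα hmα) hδ fun s => ?_
  filter_upwards [eventually_ge_atTop x₀, eventually_gt_atTop 0] with x hx hx0
  exact hb.measureReal_remainder_le hK h0 htop hRm hR s
    (B.tsum_coeffMoment_lt_top θ h0 hβ.le hγ.le (hout s) hmβ hmγ).ne hx hx0

end BranchingRandomWalk

namespace BranchingRandomWalk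

variable {Ω : Type*} [MeasurableSpace Ω] {P : Measure Ω} (B : BranchingRandomWalk P) (θ : ℝ)

/-! ### Consequences of the hypotheses on the reproduction law -/

/-- Both alternatives on the tail of `W_1` lead to a Potter bound whose upper exponent `γ` still has
`k(γ) < 1`; under the second one, `γ = α`. -/
theorem exists_potterBound [IsProbabilityMeasure P] (h0 : B.m θ ≠ 0) {α : ℝ}
    (hα : α ∈ Set.Ioo (1 : ℝ) 2) (hmα : B.moment θ α < 1) {ℓ : ℝ → ℝ} (hℓ : SlowlyVarying ℓ)
    (htail : Asymptotics.IsEquivalent atTop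
      (fun x : ℝ => P.real {ω | B.W θ 1 ω > x}) (fun x : ℝ => x ^ (-α) * ℓ x))
    (hcond : (∃ ε : ℝ, 0 < ε ∧ B.m ((α + ε) * θ) < ∞) ∨
      (∃ c : ℝ, 0 < c ∧ Tendsto ℓ atTop (𝓝 c)))
    (hpos : ∀ x, 0 < P.real {ω | B.W θ 1 ω > x}) {β : ℝ} (hβ : 0 < β) (hβα : β < α) :
    ∃ γ, α ≤ γ ∧ γ < 2 ∧ B.moment θ γ < 1 ∧
      PotterBound (fun x => P.real {ω | B.W θ 1 ω > x}) β γ := by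
  have hα0 : 0 < α := by linarith [hα.1]
  rcases hcond with ⟨ε, hε, hfin⟩ | ⟨c, hc, hlim⟩
  · have hm : B.moment θ (α + ε) ≠ ∞ := by
      rw [B.moment_eq θ (by linarith)]
      refine ENNReal.div_ne_top hfin.ne fun h => ?_
      rcases ENNReal.rpow_eq_zero_iff.1 h with h | h
      · exact h0 h.1
      · linarith [h.2]
    obtain ⟨γ, h1, h2, h3⟩ := B.exists_moment_lt_one θ h0 hα.1 hα.2 hmα hε hm
    refine ⟨γ, h1.le, h2, h3, potterBound_of_isRegVar (fun x y hxy => ?_) hpos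
      (fun x => measureReal_le_one) (isRegVar_of_isEquivalent hℓ htail) hβ hβα h1⟩
    exact measureReal_mono fun ω (hω : B.W θ 1 ω > y) => lt_of_le_of_lt hxy hω
  · exact ⟨α, le_rfl, hα.2, hmα,
      potterBound_of_tendsto (fun x => measureReal_le_one) htail hc hlim hα0⟩

theorem exists_fluctBound [IsProbabilityMeasure P] (h0 : B.m θ ≠ 0) (htop : B.m θ ≠ ∞)
    {β γ : ℝ} (hβ : 1 < β) (hγ : γ < 2) (hβγ : β ≤ γ)
    (hpos : ∀ x, 0 < P.real {ω | B.W θ 1 ω > x})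
    (hF : PotterBound (fun x => P.real {ω | B.W θ 1 ω > x}) β γ) :
    ∃ K x₀ : ℝ, 0 < K ∧ B.FluctBound θ β γ K x₀ := by
  obtain ⟨K, x₀, hK, -, hb⟩ := lintegral_quadLin_sub_one_le (B.measurable_W θ h0 htop 1)
    (B.W_nonneg θ 1) hβ hγ hβγ hpos hF
  refine ⟨K, x₀, hK, fun x hx r => ?_⟩
  simp_rw [B.fluct_nil θ h0 htop]
  exact hb x hx r

theorem partialSum_one (h0 : B.m θ ≠ 0) (htop : B.m θ ≠ ∞) (n : ℕ) (ω : Ω) :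
    B.partialSum θ (fun _ => 1) n ω = B.W θ n ω - 1 := by
  simp only [partialSum, one_mul]
  rw [Finset.sum_range_sub (fun j => B.W θ j ω), B.W_zero θ h0 htop]

theorem partialSum_neg (a : ℕ → ℝ) (n : ℕ) (ω : Ω) :
    B.partialSum θ (fun j => -a j) n ω = -B.partialSum θ a n ω := by
  simp [partialSum]

end BranchingRandomWalk

/-- Adding a constant does not change a regularly varying tail. -/
theorem tendsto_tail_add_const {Ω : Type*} [MeasurableSpace Ω] {P : Measure Ω}
    [IsFiniteMeasure P] {F : ℝ → ℝ} {α : ℝ} (hF : IsRegVar F α) (hpos : ∀ x, 0 < F x) {R : Ω → ℝ}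
    (hR : Measurable R) {b : ℝ} (h : Tendsto (fun x => P.real {ω | R ω > x} / F x) atTop (𝓝 b))
    (c : ℝ) : Tendsto (fun x => P.real {ω | R ω + c > x} / F x) atTop (𝓝 b) := by
  rw [← add_zero b]
  refine tendsto_tail_add hF hpos hR measurable_const h ?_ fun ε hε => ?_
  · refine tendsto_const_nhds.congr' ?_
    filter_upwards [eventually_ge_atTop c] with x hx
    have : {ω : Ω | c > x} = ∅ :=
      Set.eq_empty_of_forall_notMem fun ω (hω : c > x) => absurd hω (not_lt.2 hx)
    rw [this, measureReal_empty, zero_div]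
  · refine tendsto_const_nhds.congr' ?_
    filter_upwards [(tendsto_id.const_mul_atTop hε).eventually_ge_atTop |c|] with x hx
    have : {ω : Ω | ε * x < |R ω| ∧ ε * x < |c|} = ∅ :=
      Set.eq_empty_of_forall_notMem fun ω hω => absurd hω.2 (not_lt.2 hx)
    rw [this, measureReal_empty, zero_div]

theorem theorem2 {Ω : Type*} [MeasurableSpace Ω] (P : Measure Ω) [IsProbabilityMeasure P]
    (B : BranchingRandomWalk P) (hsuper : B.Supercritical)
    (θ : ℝ) (hθ : B.m θ < ∞)
    (α : ℝ) (hα : α ∈ Set.Ioo (1 : ℝ) 2)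
    (hκ : B.kappa α θ < 1)
    (ℓ : ℝ → ℝ) (hℓ : SlowlyVarying ℓ)
    (htail : Asymptotics.IsEquivalent atTop
      (fun x : ℝ => P.real {ω | B.W θ 1 ω > x}) (fun x : ℝ => x ^ (-α) * ℓ x))
    -- either the moment condition holds, or `ℓ` has a positive finite limit
    (hcond : (∃ ε : ℝ, 0 < ε ∧ B.m ((α + ε) * θ) < ∞) ∨
      (∃ c : ℝ, 0 < c ∧ Tendsto ℓ atTop (𝓝 c))) :
    (∀ a : ℕ → ℝ, (∃ C : ℝ, ∀ j, |a j| ≤ C) →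
      ∃ R : Ω → ℝ, Measurable R ∧
        -- almost sure convergence of the series to `R`
        (∀ᵐ ω ∂P, Tendsto (fun n => B.partialSum θ a n ω) atTop (𝓝 (R ω))) ∧
        -- convergence in `L_p`
        (∀ p : ℝ, p ∈ Set.Ico 1 α →
          MemLp R (ENNReal.ofReal p) P ∧
          (∀ n, MemLp (B.partialSum θ a n) (ENNReal.ofReal p) P) ∧
          Tendsto (fun n => eLpNorm (B.partialSum θ a n - R) (ENNReal.ofReal p) P)
            atTop (𝓝 0)) ∧
        -- right tail
        Tendsto (fun x : ℝ => P.real {ω | R ω > x} / P.real {ω | B.W θ 1 ω > x}) atTop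
          (𝓝 (∑' j : ℕ, (B.kappa α θ).toReal ^ j * (max (a j) 0) ^ α)) ∧
        -- left tail
        Tendsto (fun x : ℝ => P.real {ω | R ω < -x} / P.real {ω | B.W θ 1 ω > x}) atTop
          (𝓝 (∑' j : ℕ, (B.kappa α θ).toReal ^ j * (max (-a j) 0) ^ α))) ∧
    -- the tail of the limit of the martingale
    (∃ Winf : Ω → ℝ, Measurable Winf ∧
      (∀ᵐ ω ∂P, Tendsto (fun n => B.W θ n ω) atTop (𝓝 (Winf ω))) ∧
      Asymptotics.IsEquivalent atTop (fun x : ℝ => P.real {ω | Winf ω > x})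
        (fun x : ℝ => (1 - (B.kappa α θ).toReal)⁻¹ * P.real {ω | B.W θ 1 ω > x})) := by
  have h0 : B.m θ ≠ 0 := B.m_ne_zero θ hsuper
  have htop : B.m θ ≠ ∞ := hθ.ne
  have hα0 : 0 < α := by linarith [hα.1]
  rw [← B.moment_eq_kappa θ hα0] at hκ ⊢
  have hF := isRegVar_of_isEquivalent hℓ htail
  have hpos : ∀ x, 0 < P.real {ω | B.W θ 1 ω > x} := fun x => by
    obtain ⟨y, hy, hxy⟩ := ((eventually_pos_of_isEquivalent hℓ htail).and
      (eventually_ge_atTop x)).exists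
    exact hy.trans_le (measureReal_mono fun ω (hω : B.W θ 1 ω > y) => lt_of_le_of_lt hxy hω)
  have hpotter : ∀ β, 0 < β → β < α → _ := fun β h1 h2 =>
    B.exists_potterBound θ h0 hα hκ hℓ htail hcond hpos h1 h2
  -- summability of the increments in `L_q` for all `q < α`
  have hsum : ∀ q, 1 ≤ q → q < α → ∑' n, eLpNorm (fun ω => B.W θ (n + 1) ω - B.W θ n ω)
      (ENNReal.ofReal q) P < ∞ := by
    intro q hq1 hqα
    set p := (q + α) / 2 with hp
    have hqp : q < p := by linarith
    have hpα : p < α := by linarith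
    obtain ⟨γ, hγ, -, -, hpot⟩ := hpotter ((p + α) / 2) (by linarith) (by linarith)
    have hV := lintegral_rpow_lt_top_of_potterBound (p := p) (B.measurable_W θ h0 htop 1)
      (B.W_nonneg θ 1) (by linarith) (by linarith) (by linarith) hpot
    exact B.tsum_eLpNorm_increment_lt_top θ h0 htop (by linarith) (by linarith [hα.2]) hqp.le
      (B.moment_lt_one θ h0 htop hκ (by linarith) hpα.le)
      (B.lintegral_fluct_rpow_lt_top θ h0 htop (by linarith) hV)
  -- for the tails any exponent `β` in `(1, α)` will do
  obtain ⟨γ, hγα, hγ2, hmγ, hpot⟩ := hpotter ((1 + α) / 2) (by linarith) (by linarith [hα.1])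
  have hα1 := hα.1
  obtain ⟨K, x₀, hK, hb⟩ := B.exists_fluctBound θ h0 htop (by linarith) hγ2 (by linarith) hpos hpot
  have hmβ : B.moment θ ((1 + α) / 2) < 1 :=
    B.moment_lt_one θ h0 htop hκ (by linarith) (by linarith)
  have hmain : ∀ (a : ℕ → ℝ) (C : ℝ), (∀ j, |a j| ≤ C) → ∀ R : Ω → ℝ, Measurable R →
      (∀ᵐ ω ∂P, Tendsto (fun n => B.partialSum θ a n ω) atTop (𝓝 (R ω))) →
      Tendsto (fun x => P.real {ω | R ω > x} / P.real {ω | B.W θ 1 ω > x}) atTop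
        (𝓝 (∑' j, (B.moment θ α).toReal ^ j * (max (a j) 0) ^ α)) := fun a C ha R hRm hR =>
    B.tendsto_tail_limit θ h0 htop hα0 (by linarith) (by linarith) hF hpos hb hK.le hκ hmβ hmγ
      ha hRm hR
  have hseries : ∀ a : ℕ → ℝ, Measurable fun ω => ∑' j, a j * (B.W θ (j + 1) ω - B.W θ j ω) :=
    fun a => Measurable.tsum fun j => ((B.measurable_W θ h0 htop (j + 1)).sub
      (B.measurable_W θ h0 htop j)).const_mul _
  refine ⟨fun a ⟨C, ha⟩ => ?_, ?_⟩
  · have hR := B.ae_tendsto_partialSum θ h0 htop ha (hsum 1 le_rfl hα1)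
    refine ⟨_, hseries a, hR, fun p hp => ?_, hmain a C ha _ (hseries a) hR, ?_⟩
    · exact B.memLp_and_tendsto_eLpNorm θ h0 htop ha hp.1 (hsum p hp.1 hp.2) (hseries a) hR
    · refine (hmain (fun j => -a j) C (fun j => by rw [abs_neg]; exact ha j) _ (hseries a).neg
        ?_).congr fun x => ?_
      · filter_upwards [hR] with ω hω
        simp_rw [B.partialSum_neg]
        exact hω.neg
      · congr 2
        ext ω
        simp only [Set.mem_ofPred_eq, gt_iff_lt, Pi.neg_apply]
        exact lt_neg
  · have hone : ∀ j : ℕ, |(fun _ : ℕ => (1 : ℝ)) j| ≤ 1 := fun j => by simp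
    have hR := B.ae_tendsto_partialSum θ h0 htop hone (hsum 1 le_rfl hα1)
    have hlim := tendsto_tail_add_const hF hpos (hseries fun _ => 1)
      (hmain _ 1 hone _ (hseries fun _ => 1) hR) 1
    have hκ1 : (B.moment θ α).toReal < 1 := by
      rw [← ENNReal.toReal_one]
      exact (ENNReal.toReal_lt_toReal (hκ.trans ENNReal.one_lt_top).ne ENNReal.one_ne_top).2 hκ
    simp only [zero_le_one, sup_of_le_left, Real.one_rpow, mul_one] at hlim
    rw [tsum_geometric_of_lt_one ENNReal.toReal_nonneg hκ1] at hlim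
    have hκ2 : 0 < (1 - (B.moment θ α).toReal)⁻¹ := inv_pos.2 (by linarith)
    refine ⟨_, (hseries fun _ => 1).add_const 1, ?_, ?_⟩
    · filter_upwards [hR] with ω hω
      refine (hω.add_const 1).congr fun n => ?_
      rw [B.partialSum_one θ h0 htop]
      ring
    · refine (Asymptotics.isEquivalent_iff_tendsto_one (Eventually.of_forall fun x =>
        (mul_pos hκ2 (hpos x)).ne')).2 ?_
      have h1 := hlim.div_const (1 - (B.moment θ α).toReal)⁻¹
      rw [div_self hκ2.ne'] at h1
      refine h1.congr fun x => ?_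
      rw [Pi.div_apply, div_div, mul_comm]
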